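/- Let $\lambda_1,\lambda_2>0$ and let $H$ be the off-diagonal Fibonacci Hamiltonian, i.e. the bounded self-adjoint operator on $\ell^2(\mathbb Z)$ given by $$(H\psi)(n)=a(n)\psi(n+1)+a(n-1)\psi(n-1),\qquad a(n)=(\lambda_1-\lambda_2)\bigl(\lfloor (n+1)\beta\rfloor-\lfloor n\beta\rfloor\bigr)+\lambda_2,\qquad \beta=\tfrac{\sqrt5-1}{2},$$ where $\lfloor x\rfloor$ is the largest integer $\le x$. Let $(\delta_n)_{n\in\mathbb Z}$ be the canonical basis and put $$a(n,t)=|\langle e^{-itH}\delta_1,\delta_n\rangle|^2,\qquad \langle a(n,T)\rangle=\frac2T\int_0^\infty e^{-2t/T}a(n,t)\,dt,$$ $$P(N,t)=\sum_{|n|>N}a(n,t),\qquad \langle P(N,T)\rangle=\sum_{|n|>N}\langle a(n,T)\rangle .$$ For $\alpha\ge 0$ let $$S^+(\alpha)=-\limsup_{t\to\infty}\frac{\ln P(t^\alpha-2,t)}{\ln t}\in[-\infty,\infty]\quad(\ln 0=-\infty),\qquad \alpha_u^+=\sup\{\alpha\ge 0: S^+(\alpha)<\infty\}\in[0,\infty],$$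 and let $\widetilde S^+$, $\widetilde\alpha_u^+$ be defined in the same way with $\langle P(t^\alpha-2,t)\rangle$ in place of $P(t^\alpha-2,t)$. Assume $c=\dfrac{\lambda_1^2-\lambda_2^2}{\lambda_1\lambda_2}>8$ and put $\xi_c=c-2+\sqrt{c^2-4c+1}$. Then $$\widetilde\alpha_u^+\le\frac{2\log\frac{\sqrt5+1}{2}}{\log\xi_c}\qquad\text{and}\qquad \alpha_u^+\le\frac{2\log\frac{\sqrt5+1}{2}}{\log\xi_c},$$ and this bound is sub-ballistic, that is, $\dfrac{2\log\frac{\sqrt5+1}{2}}{\log\xi_c}<1$. -/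

import Mathlib

open Filter MeasureTheory

noncomputable section

/-- The Hilbert space `ℓ²(ℤ)` of complex square-summable sequences indexed by the integers. -/
abbrev EllTwo : Type := lp (fun _ : ℤ => ℂ) 2

/-- A bounded weight times the values of a square-summable sequence read along a permutation of `ℤ`
is square-summable. -/
theorem weightedShift_memℓp {a : ℤ → ℝ} (ha : ∃ C : ℝ, ∀ n, |a n| ≤ C) (e : ℤ ≃ ℤ) (ψ : EllTwo) :
    Memℓp (fun n : ℤ => (a n : ℂ) * ψ (e n)) 2 := by
  obtain ⟨C, hC⟩ := ha
  have h2 : (0 : ℝ) < (2 : ENNReal).toReal := by norm_num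
  have hs : Memℓp (fun n : ℤ => ψ (e n)) 2 :=
    memℓp_gen ((e.summable_iff (f := fun n => ‖ψ n‖ ^ (2 : ENNReal).toReal)).2
      ((lp.memℓp ψ).summable h2))
  refine (hs.const_mul (C : ℂ)).mono' fun n => ?_
  rw [norm_mul, norm_mul, Complex.norm_real, Complex.norm_real]
  exact mul_le_mul_of_nonneg_right ((hC n).trans (le_abs_self C)) (norm_nonneg _)

/-- The bounded operator `ψ ↦ (n ↦ a(n) ψ(e(n)))` on `ℓ²(ℤ)`, for a bounded weight `a` and a
permutation `e` of `ℤ`. -/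
def weightedShift (a : ℤ → ℝ) (ha : ∃ C : ℝ, ∀ n, |a n| ≤ C) (e : ℤ ≃ ℤ) : EllTwo →L[ℂ] EllTwo :=
  LinearMap.mkContinuousOfExistsBound
    { toFun := fun ψ => ⟨fun n : ℤ => (a n : ℂ) * ψ (e n), weightedShift_memℓp ha e ψ⟩
      map_add' := fun ψ φ => by
        ext n
        exact mul_add _ _ _
      map_smul' := fun c ψ => by
        ext n
        simp [mul_left_comm] }
    (by
      obtain ⟨C, hC⟩ := ha
      have h2 : (0 : ℝ) < (2 : ENNReal).toReal := by norm_num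
      have hC0 : 0 ≤ C := (abs_nonneg _).trans (hC 0)
      refine ⟨C, fun ψ => lp.norm_le_of_forall_sum_le h2 (by positivity) fun s => ?_⟩
      have key : ∑ n ∈ s, ‖ψ (e n)‖ ^ (2 : ENNReal).toReal ≤ ‖ψ‖ ^ (2 : ENNReal).toReal := by
        have := lp.sum_rpow_le_norm_rpow h2 ψ (s.map e.toEmbedding)
        rwa [Finset.sum_map] at this
      calc ∑ n ∈ s, ‖(a n : ℂ) * ψ (e n)‖ ^ (2 : ENNReal).toReal
          ≤ ∑ n ∈ s, C ^ (2 : ENNReal).toReal * ‖ψ (e n)‖ ^ (2 : ENNReal).toReal := by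
            refine Finset.sum_le_sum fun n _ => ?_
            rw [norm_mul, Real.mul_rpow (norm_nonneg _) (norm_nonneg _), Complex.norm_real]
            exact mul_le_mul_of_nonneg_right
              (Real.rpow_le_rpow (norm_nonneg _) (hC n) h2.le) (by positivity)
        _ = C ^ (2 : ENNReal).toReal * ∑ n ∈ s, ‖ψ (e n)‖ ^ (2 : ENNReal).toReal := by
            rw [Finset.mul_sum]
        _ ≤ C ^ (2 : ENNReal).toReal * ‖ψ‖ ^ (2 : ENNReal).toReal :=
            mul_le_mul_of_nonneg_left key (by positivity)
        _ = (C * ‖ψ‖) ^ (2 : ENNReal).toReal := (Real.mul_rpow hC0 (norm_nonneg _)).symm)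

/-- The Jacobi operator on `ℓ²(ℤ)` with bounded real coefficient sequences `a` and `b`:
`(H ψ)(n) = a(n) ψ(n+1) + a(n-1) ψ(n-1) + b(n) ψ(n)`. -/
def jacobiOperator (a b : ℤ → ℝ) (ha : ∃ C : ℝ, ∀ n, |a n| ≤ C) (hb : ∃ C : ℝ, ∀ n, |b n| ≤ C) :
    EllTwo →L[ℂ] EllTwo :=
  weightedShift a ha (Equiv.addRight 1)
    + weightedShift (fun n => a (n - 1)) (ha.imp fun _ h n => h (n - 1)) (Equiv.subRight 1)
    + weightedShift b hb (Equiv.refl ℤ)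

theorem jacobiOperator_apply (a b : ℤ → ℝ) (ha : ∃ C : ℝ, ∀ n, |a n| ≤ C)
    (hb : ∃ C : ℝ, ∀ n, |b n| ≤ C) (ψ : EllTwo) (n : ℤ) :
    jacobiOperator a b ha hb ψ n
      = (a n : ℂ) * ψ (n + 1) + (a (n - 1) : ℂ) * ψ (n - 1) + (b n : ℂ) * ψ n :=
  rfl

/-- The hopping sequence of the off-diagonal Sturmian model with hopping constants `l1`, `l2` and
rotation number `β`: `a(n) = (l1 - l2) (⌊(n+1)β⌋ - ⌊nβ⌋) + l2`. -/
def sturmianHopping (l1 l2 β : ℝ) (n : ℤ) : ℝ :=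
  (l1 - l2) * (((⌊((n : ℝ) + 1) * β⌋ - ⌊(n : ℝ) * β⌋ : ℤ)) : ℝ) + l2

theorem sturmianHopping_bounded (l1 l2 β : ℝ) : ∃ C : ℝ, ∀ n, |sturmianHopping l1 l2 β n| ≤ C := by
  refine ⟨|l1 - l2| * (|β| + 1) + |l2|, fun n => ?_⟩
  refine (abs_add_le _ _).trans (add_le_add ?_ le_rfl)
  rw [abs_mul]
  refine mul_le_mul_of_nonneg_left ?_ (abs_nonneg _)
  have h1 := Int.floor_le (((n : ℝ) + 1) * β)
  have h2 := Int.lt_floor_add_one (((n : ℝ) + 1) * β)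
  have h3 := Int.floor_le ((n : ℝ) * β)
  have h4 := Int.lt_floor_add_one ((n : ℝ) * β)
  have h5 := le_abs_self β
  have h6 := neg_abs_le β
  push_cast
  rw [abs_le]
  constructor <;> linarith

/-- The off-diagonal Fibonacci Hamiltonian with hopping constants `l1`, `l2`: the Jacobi operator
with zero diagonal and Sturmian hopping of rotation number `(√5 - 1) / 2`. -/
def fibonacciHamiltonian (l1 l2 : ℝ) : EllTwo →L[ℂ] EllTwo :=
  jacobiOperator (sturmianHopping l1 l2 ((√5 - 1) / 2)) (fun _ => 0)
    (sturmianHopping_bounded l1 l2 ((√5 - 1) / 2)) ⟨0, fun _ => by simp⟩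

/-- The canonical basis vector `δ_n` of `ℓ²(ℤ)`. -/
def siteVector (n : ℤ) : EllTwo := lp.single 2 n 1

/-- `a(n,t) = |⟨e^{-itH} δ_1, δ_n⟩|²`: the probability to be at site `n` at time `t` when starting
at site `1`. -/
def siteProb (H : EllTwo →L[ℂ] EllTwo) (n : ℤ) (t : ℝ) : ℝ :=
  ‖inner ℂ (NormedSpace.exp ((-(Complex.I * (t : ℂ))) • H) (siteVector 1)) (siteVector n)‖ ^ 2

/-- The time average `⟨a(n,T)⟩ = (2/T) ∫_0^∞ e^{-2t/T} a(n,t) dt`. -/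
def siteProbAvg (H : EllTwo →L[ℂ] EllTwo) (n : ℤ) (T : ℝ) : ℝ :=
  2 / T * ∫ t in Set.Ioi (0 : ℝ), Real.exp (-2 * t / T) * siteProb H n t

/-- The outside probability `P(N,t) = ∑_{|n| > N} p(n,t)` of a family of site probabilities
`p(n,t) ≥ 0`, for a real radius `N`. -/
def outsideProb (p : ℤ → ℝ → ℝ) (N t : ℝ) : ENNReal :=
  ∑' n : {n : ℤ // N < |(n : ℝ)|}, ENNReal.ofReal (p n t)

/-- `S⁺(α) = - limsup_{t → ∞} ln P(t^α - 2, t) / ln t`, as an extended real number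
(here `ln 0 = -∞`). -/
def decayExponentUpper (p : ℤ → ℝ → ℝ) (α : ℝ) : EReal :=
  -limsup (fun t : ℝ => ENNReal.log (outsideProb p (t ^ α - 2) t) / ((Real.log t : ℝ) : EReal))
    atTop

/-- The upper transport exponent `sup {α ≥ 0 : S⁺(α) < ∞}` in the extended reals. -/
def transportExponentUpper (p : ℤ → ℝ → ℝ) : EReal :=
  sSup {x : EReal | ∃ α : ℝ, 0 ≤ α ∧ decayExponentUpper p α < ⊤ ∧ x = (α : EReal)}

/-- `α_u⁺` for the dynamics generated by `H` and started at `δ_1`. -/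
def alphaUpper (H : EllTwo →L[ℂ] EllTwo) : EReal := transportExponentUpper (siteProb H)

/-- The time-averaged exponent `α̃_u⁺` for the dynamics generated by `H` and started at `δ_1`. -/
def alphaUpperAvg (H : EllTwo →L[ℂ] EllTwo) : EReal := transportExponentUpper (siteProbAvg H)

/-- `ξ_c = c - 2 + √(c² - 4c + 1)`. -/
def xiConst (c : ℝ) : ℝ := c - 2 + √(c ^ 2 - 4 * c + 1)

end

/-! Resolvent entries of the Hamiltonian are governed by transfer matrices over Fibonacci blocks.
Their traces `x_k(z)` follow the trace map `x_{k+3} = x_{k+2} x_{k+1} - x_k`, which preserves the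
surface `x² + y² + z² - xyz - 4 = c²`. Once two consecutive traces exceed `2 + δ` in modulus, the
orbit escapes with size at least `(1 + δ)^{F_n}` after `n` more steps (`traceMap_escape_of_pair`).
The question is therefore how far from the real axis `z` must lie for `x_k` and `x_{k+1}` to be
large; the answer is a multiple of `w^{-k}` with `w = √ξ_c`.

This width comes from a slope bound: `|x_k'(E)| ≥ C w^k` at every real `E` with `|x_k(E)| ≤ 2 + δ`
(`TraceOrbit.deriv_lower_bound`). For `c > 8` an orbit that is small at some time has, up to then,
neither two consecutive large values nor three consecutive small ones. The energy derivative is a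
tangent vector of the surface. The pattern small-large-small-large-small spans two indices from its
middle value to its last and gains `2c - 4 ≥ w²` (`tangent_growth_two_iterates`). A cycle containing
a pair of small values spans three indices and gains `(c - 1)² ≥ w³` (`tangent_growth_one_iterate`,
twice). Since `x_k` has only real zeros, the slope bound confines `{|x_k| ≤ 2 + δ}` to a strip of
width of order `w^{-k}` in the complex plane (`Polynomial.mul_abs_im_le_of_norm_aeval_le`).

For the dynamics, the Laplace transform of `e^{-itH} δ₁` along `Im z = η` is `i (z - H)⁻¹ δ₁`. The
initial Fibonacci blocks of the half-line occur twice in a row, so a large trace makes a bounded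
solution small after one block, and monotonicity of the current keeps it small beyond
(`halfLine_decay`). A reflection symmetry of the hopping covers the left half-line. With `η = 1/T`
and `w^k` a large multiple of `T`, the resolvent beyond `F_{k+j}` is at most `(1 + δ)^{-F_j}` up to
powers of `T` and `|z|`. If `α > log φ / log w` and `T ≤ |n|^{1/α}`, then `j` can be a positive
multiple of `log |n|`, so `F_j` beats every multiple of `log |n|`. Fourier inversion in `Re z` then
gives smallness beyond every power of `|n|`, pointwise in time, and this one estimate serves both
exponents. The bound is sub-ballistic because `w > 2 > φ`. -/

/-! ### Growth of tangent vectors of the invariant surface -/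

theorem markov_root_bounds {c δ s a m : ℝ} (hc : 8 < c) (hδ : 0 < δ) (hδc : δ * (100 * c) ≤ 1)
    (hs : |s| ≤ 2 + δ) (ha : |a| ≤ 2 + δ) (hinv : m ^ 2 + s ^ 2 + a ^ 2 - m * s * a - 4 = c ^ 2) :
    2 * c - 2 * δ ≤ |2 * m - s * a| ∧ |2 * m - s * a| ≤ 2 * c + 1 / 2 := by
  have hδ1 : δ ≤ 1 / 800 := by nlinarith
  -- The invariant is quadratic in `m`, and `2m - sa` is a square root of its discriminant. The
  -- discriminant is at least `4c²` when `|s|, |a| ≤ 2`; the margin `δ` loses at most `41δ`. For the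
  -- upper bound, `c > 8` makes `2c` exceed the extra 16.
  have hR : (2 * m - s * a) ^ 2 = 4 * c ^ 2 + (4 - s ^ 2) * (4 - a ^ 2) := by
    linear_combination 4 * hinv
  have hs2 : s ^ 2 ≤ 4 + 5 * δ := by
    have := sq_abs s
    nlinarith [abs_nonneg s]
  have ha2 : a ^ 2 ≤ 4 + 5 * δ := by
    have := sq_abs a
    nlinarith [abs_nonneg a]
  have hlo : -(41 * δ) ≤ (4 - s ^ 2) * (4 - a ^ 2) := by
    nlinarith [mul_nonneg hδ.le (sq_nonneg s), mul_nonneg hδ.le (sq_nonneg a),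
      mul_nonneg (sub_nonneg.2 hs2) (sub_nonneg.2 ha2)]
  have hhi : (4 - s ^ 2) * (4 - a ^ 2) ≤ 16 := by
    nlinarith [sq_nonneg s, sq_nonneg a, mul_nonneg (sub_nonneg.2 hs2) (sub_nonneg.2 ha2),
      mul_nonneg (sq_nonneg s) (sub_nonneg.2 ha2), mul_nonneg (sq_nonneg a) (sub_nonneg.2 hs2)]
  constructor
  · apply le_abs_self (2 * c - 2 * δ) |>.trans
    rw [← sq_le_sq, hR]
    nlinarith
  · refine abs_le_of_sq_le_sq ?_ (by linarith)
    rw [hR]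
    nlinarith

set_option maxHeartbeats 1000000 in
/-- Growth of a tangent vector of the invariant surface over one iterate of the trace map between
three values below the threshold. -/
theorem tangent_growth_one_iterate {c δ s₀ s m s₁ y₀ y ym y₁ : ℝ} (hc : 8 < c) (hδ : 0 < δ)
    (hδc : δ * (100 * c) ≤ 1) (h0 : |s₀| ≤ 2 + δ) (hs : |s| ≤ 2 + δ) (h1 : |s₁| ≤ 2 + δ)
    (hs1 : s₁ = m * s - s₀) (hinv : m ^ 2 + s ^ 2 + s₀ ^ 2 - m * s * s₀ - 4 = c ^ 2)
    (htan : (2 * m - s * s₀) * ym = (m * s₀ - 2 * s) * y + (m * s - 2 * s₀) * y₀)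
    (hy1 : y₁ = m * y + s * ym - y₀) (hy : (c - 1) * |y₀| ≤ |y|) :
    (c - 1) * |y| ≤ |y₁| := by
  have hδ1 : δ ≤ 1 / 800 := by nlinarith
  have hinv' : m ^ 2 + s ^ 2 + s₁ ^ 2 - m * s * s₁ - 4 = c ^ 2 := by
    rw [hs1]; linear_combination hinv
  obtain ⟨hRl, hRu⟩ := markov_root_bounds hc hδ hδc hs h0 hinv
  obtain ⟨hQl, hQu⟩ := markov_root_bounds hc hδ hδc hs h1 hinv'
  set R := 2 * m - s * s₀ with hR
  set Q := 2 * m - s * s₁ with hQ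
  -- `R` is the derivative of the invariant in `m`. Multiplying by it lets the tangency relation
  -- eliminate `ym`, so that only derivatives at small values remain.
  have key : R * y₁ = 2 * (m ^ 2 - s ^ 2) * y - Q * y₀ := by
    rw [hy1, hQ, hs1]
    have : R * (m * y + s * ym - y₀) = R * m * y + s * (R * ym) - R * y₀ := by ring
    rw [this, htan, hR]; ring
  have hm30 : 30 ≤ m ^ 2 := by
    have e1 : |R| ≤ 2 * |m| + |s| * |s₀| := by
      rw [hR, ← abs_mul]
      have := abs_sub (2 * m) (s * s₀)
      rwa [abs_mul 2 m, abs_two] at this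
    have e2 : |s| * |s₀| ≤ (2 + δ) * (2 + δ) :=
      mul_le_mul hs h0 (abs_nonneg _) (by linarith)
    have e3 : (2 + δ) * (2 + δ) ≤ 4.1 := by nlinarith
    have : 5.5 ≤ |m| := by linarith
    rw [← sq_abs m]
    nlinarith
  have hsum : R + Q = m * (4 - s ^ 2) := by rw [hR, hQ, hs1]; ring
  have hsm : (m * s) ^ 2 ≤ 17 := by
    have : m * s = s₀ + s₁ := by rw [hs1]; ring
    rw [this, ← sq_abs]
    have h4 : |s₀ + s₁| ≤ 4.1 := (abs_add_le s₀ s₁).trans (by linarith)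
    nlinarith [abs_nonneg (s₀ + s₁)]
  have hs2 : s ^ 2 ≤ 17 / 30 := by nlinarith [sq_nonneg s]
  have hprod : 0 < R * Q := by
    have e1 : R * Q = 4 * m ^ 2 - 2 * (m * s) ^ 2 + s ^ 2 * (s₀ * s₁) := by
      rw [hR, hQ, hs1]; ring
    have e2 : |s₀ * s₁| ≤ 5 := by
      rw [abs_mul]
      calc |s₀| * |s₁| ≤ 2.1 * 2.1 :=
            mul_le_mul (by linarith) (by linarith) (abs_nonneg _) (by norm_num)
        _ ≤ 5 := by norm_num
    have e3 := mul_le_mul_of_nonneg_left (abs_le.1 e2).1 (sq_nonneg s)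
    rw [e1]
    linarith
  -- `R` and `Q` have the same sign and sum to `m (4 - s²)`, so their lower bounds give `|m| ≥ c -
  -- δ`, sharper than the triangle inequality applied to `R` alone.
  have habs : |R| + |Q| = |m| * (4 - s ^ 2) := by
    rw [← abs_of_pos (show 0 < 4 - s ^ 2 by linarith), ← abs_mul, ← hsum]
    rcases pos_and_pos_or_neg_and_neg_of_mul_pos hprod with ⟨h, h'⟩ | ⟨h, h'⟩
    · rw [abs_of_pos h, abs_of_pos h', abs_of_pos (add_pos h h')]
    · rw [abs_of_neg h, abs_of_neg h', abs_of_neg (add_neg h h')]; ring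
  have hmc : c - δ ≤ |m| := by
    have := mul_nonneg (abs_nonneg m) (sq_nonneg s)
    linarith
  have hm2 : c ^ 2 - 1 ≤ m ^ 2 := by
    rw [← sq_abs m]
    have : (c - δ) ^ 2 ≤ |m| ^ 2 := pow_le_pow_left₀ (by linarith) hmc 2
    have h2 : 0 ≤ δ ^ 2 := sq_nonneg δ
    linarith
  have hR0 : 0 < |R| := by linarith
  have h3 : 2 * (m ^ 2 - s ^ 2) * |y| - |Q| * |y₀| ≤ |R| * |y₁| := by
    rw [← abs_mul R, key]
    have := abs_sub_abs_le_abs_sub (2 * (m ^ 2 - s ^ 2) * y) (Q * y₀)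
    rw [abs_mul, abs_mul Q, abs_of_nonneg (show 0 ≤ 2 * (m ^ 2 - s ^ 2) by linarith)] at this
    exact this
  have h4 : |Q| * |y₀| ≤ 3 * |y| := by
    have : |Q| ≤ 3 * (c - 1) := by linarith
    have := mul_le_mul_of_nonneg_right this (abs_nonneg y₀)
    linarith
  refine le_of_mul_le_mul_left ?_ hR0
  have h5 : (c - 1) * |R| ≤ 2 * (m ^ 2 - s ^ 2) - 3 := by
    have : (c - 1) * |R| ≤ (c - 1) * (2 * c + 1 / 2) :=
      mul_le_mul_of_nonneg_left hRu (by linarith)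
    linarith
  have h6 := mul_le_mul_of_nonneg_right h5 (abs_nonneg y)
  linarith

/-- The case `a + b ≤ 0` of the two-iterate estimate, with `u = |a + b|`, `v = |b - a|` and `B` the
mean of the two discriminant roots. This is the tight case: passing from `S²` to `B²` costs `B s u`,
which the slack `4B` in `hmain` has to pay for. It can, because `(1 - s) S = u` makes `B (4 - s u)`
at least `B (4 - u) + u²`, and `u ≤ 4 + 2δ`. -/
theorem two_iterates_bound_of_le_one {c δ s u v D S B : ℝ} (hs0 : 0.65 ≤ s) (hs1 : s ≤ 1)
    (hu : 0 ≤ u) (hv : 0 ≤ v) (huv : u + v ≤ 4.01) (hu2 : u ≤ 4 + 2 * δ) (hB : 15.9 ≤ B)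
    (hδB : 2 * δ * B ≤ 0.05 + 2 * δ * 15.9) (hSB : S ≤ B) (h1 : (1 - s) * S = u)
    (hD : (s + 1) ^ 2 * D ^ 2 = v ^ 2) (hmain : (2 * c - 4) * B ≤ B ^ 2 - 4 * B + 0.05) :
    (2 * c - 4) * B + 0.82 * (u * v) + 2.36
      ≤ B ^ 2 - B * (s * u) + s ^ 2 * u ^ 2 / 4 - D ^ 2 - (u ^ 2 - v ^ 2) / 4
        + 2 * s * (1 - s ^ 2) := by
  have hs2 : 0.42 ≤ s ^ 2 := by nlinarith only [hs0]
  have hs2' : s ^ 2 ≤ 1 := by nlinarith only [hs0, hs1]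
  have g1 : D ^ 2 ≤ 0.38 * v ^ 2 := by
    have : 2.7 * D ^ 2 ≤ (s + 1) ^ 2 * D ^ 2 :=
      mul_le_mul_of_nonneg_right (by nlinarith only [hs0]) (sq_nonneg D)
    linarith only [this, hD, sq_nonneg v]
  have g2 : 0 ≤ 2 * s * (1 - s ^ 2) := mul_nonneg (by linarith) (by linarith)
  have g4 : u ^ 2 ≤ B * ((1 - s) * u) := by
    have e : u ≤ B * (1 - s) := by
      have := mul_le_mul_of_nonneg_left hSB (by linarith : 0 ≤ 1 - s)
      linarith only [this, h1]
    have := mul_le_mul_of_nonneg_right e hu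
    linarith only [this]
  have g5 : 15.9 * (4.01 - u) - 0.21 ≤ B * (4 - u) := by
    have := mul_le_mul_of_nonneg_left hu2 (by linarith : 0 ≤ B - 15.9)
    linarith only [this, hδB]
  have g7 : 0.1 * u ^ 2 ≤ s ^ 2 * u ^ 2 / 4 := by
    have : 0.42 * u ^ 2 ≤ s ^ 2 * u ^ 2 := mul_le_mul_of_nonneg_right hs2 (sq_nonneg u)
    linarith only [this, sq_nonneg u]
  have g8 : 0 ≤ 15.9 * (4.01 - u) - 0.21 - 0.82 * (u * v) + 0.84 * u ^ 2 - 0.13 * v ^ 2 - 2.41 := by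
    have e1 : u * v ≤ u * (4.01 - u) := mul_le_mul_of_nonneg_left (by linarith) hu
    have e2 : v ^ 2 ≤ (4.01 - u) ^ 2 := pow_le_pow_left₀ hv (by linarith) 2
    nlinarith only [e1, e2, hu, huv, hv, sq_nonneg (u - 4)]
  linarith only [g1, g2, g4, g5, g7, g8, hmain, sq_nonneg u]

/-- The case `a + b ≥ 0`: here `S²` contains the nonnegative term `B s (a + b)`, which can be
dropped, and the slack `4B` absorbs all lower-order terms. -/
theorem two_iterates_bound_of_one_le {c s u v D B : ℝ} (hs1 : 1 ≤ s) (hs2 : s ≤ 1.35) (hu : 0 ≤ u)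
    (hv : 0 ≤ v) (huv : u + v ≤ 4.01) (hD : (s + 1) ^ 2 * D ^ 2 = v ^ 2)
    (hB : 15.9 ≤ B) (hmain : (2 * c - 4) * B ≤ B ^ 2 - 4 * B + 0.05) :
    (2 * c - 4) * B + 0.82 * (u * v) + 2.36
      ≤ B ^ 2 + s ^ 2 * u ^ 2 / 4 - D ^ 2 - (u ^ 2 - v ^ 2) / 4 + 2 * s * (1 - s ^ 2) := by
  have g1 : D ^ 2 ≤ v ^ 2 / 4 := by
    have : 4 * D ^ 2 ≤ (s + 1) ^ 2 * D ^ 2 :=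
      mul_le_mul_of_nonneg_right (by nlinarith only [hs1]) (sq_nonneg D)
    linarith only [this, hD]
  have g2 : -3 ≤ 2 * s * (1 - s ^ 2) := by
    have : s ^ 2 ≤ 1.9 := by nlinarith only [hs1, hs2]
    nlinarith only [this, hs1, hs2]
  have g7 : u ^ 2 / 4 ≤ s ^ 2 * u ^ 2 / 4 := by
    have : 1 * u ^ 2 ≤ s ^ 2 * u ^ 2 :=
      mul_le_mul_of_nonneg_right (by nlinarith only [hs1]) (sq_nonneg u)
    linarith only [this]
  have g8 : u * v ≤ 4.1 := by
    have : (u + v) ^ 2 ≤ 4.01 ^ 2 := pow_le_pow_left₀ (by linarith) huv 2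
    nlinarith only [sq_nonneg (u - v), this]
  linarith only [g1, g2, g7, g8, hmain, hB]

-- The right side is the factor that multiplies `y` after two steps. The data are symmetric under
-- `(a, m) ↔ (b, l)`, so sums and differences decouple: `(s - 1)(l + m) = a + b` and `(s + 1)(l - m)
-- = b - a`. Since `l + m` is large, `s` is close to 1. In terms of the mean `B ≥ 2c - 2δ` of the
-- two discriminant roots, the main comparison is between `B²` with its corrections and `(2c - 4)
-- B`.
set_option maxHeartbeats 2000000 in
theorem tangent_growth_two_iterates_of_pos {c δ a m s l b : ℝ} (hc : 8 < c) (hδ : 0 < δ)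
    (hδc : δ * (100 * c) ≤ 1) (hm : 0 < m) (hs0 : 0 < s) (ha : |a| ≤ 2 + δ) (hs : |s| ≤ 2 + δ)
    (hb : |b| ≤ 2 + δ) (hl : l = s * m - a) (hbl : b = l * s - m)
    (hinv : m ^ 2 + s ^ 2 + a ^ 2 - m * s * a - 4 = c ^ 2) :
    (2 * c - 4) * |2 * m - s * a| + |2 * l - s * b| / (c - 1)
      ≤ 4 * l * m - a * b + 2 * s * (1 - s ^ 2) := by
  have hδ1 : δ ≤ 1 / 800 := by nlinarith
  have hinv' : l ^ 2 + s ^ 2 + b ^ 2 - l * s * b - 4 = c ^ 2 := by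
    rw [hbl, hl]; linear_combination hinv
  obtain ⟨hRl, hRu⟩ := markov_root_bounds hc hδ hδc hs ha hinv
  obtain ⟨hQl, hQu⟩ := markov_root_bounds hc hδ hδc hs hb hinv'
  have hsa : |s * a| ≤ 4.1 := by
    rw [abs_mul]
    exact (mul_le_mul hs ha (abs_nonneg _) (by linarith)).trans (by nlinarith)
  have hsb : |s * b| ≤ 4.1 := by
    rw [abs_mul]
    exact (mul_le_mul hs hb (abs_nonneg _) (by linarith)).trans (by nlinarith)
  have hl0 : -2.1 < l := by
    have := mul_pos hs0 hm
    have := (abs_le.1 ha).2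
    linarith
  have hm5 : 5.8 ≤ m := by
    rcases abs_cases (2 * m - s * a) with h | h <;> linarith [(abs_le.1 hsa).1, (abs_le.1 hsa).2]
  have hl5 : 5.8 ≤ l := by
    rcases abs_cases (2 * l - s * b) with h | h <;> linarith [(abs_le.1 hsb).1, (abs_le.1 hsb).2]
  rw [abs_of_pos (by linarith [(abs_le.1 hsa).2] : 0 < 2 * m - s * a)] at hRl hRu ⊢
  rw [abs_of_pos (by linarith [(abs_le.1 hsb).2] : 0 < 2 * l - s * b)] at hQl hQu ⊢
  have hQ : (2 * l - s * b) / (c - 1) ≤ 2.36 := by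
    rw [div_le_iff₀ (by linarith)]; linarith
  obtain ⟨ha1, ha2⟩ := abs_le.1 ha
  obtain ⟨hb1, hb2⟩ := abs_le.1 hb
  clear hinv hinv' ha hb hs hsa hsb hl0
  obtain ⟨S, hS⟩ : ∃ S, S = l + m := ⟨_, rfl⟩
  obtain ⟨σ, hσ⟩ : ∃ σ, σ = a + b := ⟨_, rfl⟩
  obtain ⟨d, hd⟩ : ∃ d, d = b - a := ⟨_, rfl⟩
  obtain ⟨D, hD⟩ : ∃ D, D = l - m := ⟨_, rfl⟩
  obtain ⟨B, hB⟩ : ∃ B, B = S - s * σ / 2 := ⟨_, rfl⟩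
  have f1 : (s - 1) * S = σ := by rw [hS, hσ]; linear_combination -hl - hbl
  have f2 : (s + 1) * D = d := by rw [hD, hd]; linear_combination hl - hbl
  have f3 : (2 * m - s * a) + (2 * l - s * b) = 2 * B := by rw [hB, hS, hσ]; ring
  have f4 : (2 * m - s * a) = B - D + s * d / 2 := by rw [hB, hS, hσ, hD, hd]; ring
  have hK : 4 * l * m - a * b + 2 * s * (1 - s ^ 2)
      = S ^ 2 - D ^ 2 - (σ ^ 2 - d ^ 2) / 4 + 2 * s * (1 - s ^ 2) := by
    rw [hS, hσ, hD, hd]; ring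
  have hS11 : 11.6 ≤ S := by linarith
  have hBl : 2 * c - 2 * δ ≤ B := by linarith
  have hBu : B ≤ 2 * c + 1 / 2 := by linarith
  have hδB : 2 * δ * B ≤ 0.05 := by
    have := mul_le_mul_of_nonneg_left hBu hδ.le
    linarith
  have hσd : |σ| + |d| ≤ 4.01 := by
    rw [hσ, hd]
    rcases abs_cases (a + b) with h | h <;> rcases abs_cases (b - a) with h' | h' <;> linarith
  have hσ4 : |σ| ≤ 4.01 := by linarith [abs_nonneg d]
  have hs1 : |s - 1| ≤ 0.35 := by
    have : |s - 1| * S = |σ| := by rw [← f1, abs_mul, abs_of_pos (by linarith : 0 < S)]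
    have h2 := mul_le_mul_of_nonneg_left hS11 (abs_nonneg (s - 1))
    linarith
  obtain ⟨hs1a, hs1b⟩ := abs_le.1 hs1
  have hsσ : |s * σ / 2| ≤ 2.8 := by
    rw [abs_div, abs_mul, abs_of_pos hs0, abs_two]
    have : s * |σ| ≤ 1.35 * 4.01 := mul_le_mul (by linarith) hσ4 (abs_nonneg _) (by norm_num)
    linarith
  have hSc : 2 * c - 4 ≤ S := by linarith [(abs_le.1 hsσ).1]
  -- The root `2m - sa` differs from `B` by `(s - 1)(s + 2) d / (2 (s + 1))`. The factor `|s - 1|`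
  -- equals `|σ| / S`, and `S ≥ 2c - 4` cancels the weight `2c - 4`.
  have hasym : (2 * c - 4) * (-D + s * d / 2) ≤ 0.82 * (|σ| * |d|) := by
    have e1 : 2 * (s + 1) * (-D + s * d / 2) = (s - 1) * (s + 2) * d := by
      linear_combination -2 * f2
    have e2 : 2 * (s + 1) * |-D + s * d / 2| = |s - 1| * (s + 2) * |d| := by
      rw [← abs_of_pos (by linarith : 0 < 2 * (s + 1)), ← abs_mul, e1, abs_mul, abs_mul,
        abs_of_pos (by linarith : 0 < s + 2)]
    have e3 : |s - 1| * S = |σ| := by rw [← f1, abs_mul, abs_of_pos (by linarith : 0 < S)]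
    have e4 : |-D + s * d / 2| ≤ 0.82 * (|s - 1| * |d|) := by
      have hsd := mul_nonneg (abs_nonneg (s - 1)) (abs_nonneg d)
      have : (s + 1) * |-D + s * d / 2| ≤ (s + 1) * (0.82 * (|s - 1| * |d|)) := by
        have := mul_nonneg hsd (by linarith : 0 ≤ 0.64 * s - 0.36)
        nlinarith
      exact le_of_mul_le_mul_left this (by linarith)
    calc (2 * c - 4) * (-D + s * d / 2) ≤ (2 * c - 4) * |-D + s * d / 2| :=
          mul_le_mul_of_nonneg_left (le_abs_self _) (by linarith)
      _ ≤ S * (0.82 * (|s - 1| * |d|)) :=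
          mul_le_mul hSc e4 (abs_nonneg _) (by linarith)
      _ = 0.82 * (|s - 1| * S * |d|) := by ring
      _ = 0.82 * (|σ| * |d|) := by rw [e3]
  have hmain : (2 * c - 4) * B ≤ B ^ 2 - 4 * B + 0.05 := by
    have := mul_le_mul_of_nonneg_right (by linarith : 2 * c ≤ B + 2 * δ) (by linarith : 0 ≤ B)
    linarith
  have hS2 : S ^ 2 = B ^ 2 + B * (s * σ) + s ^ 2 * σ ^ 2 / 4 := by
    have : S = B + s * σ / 2 := by linarith
    rw [this]; ring
  have hsS : s = 1 + σ / S := by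
    have : S ≠ 0 := by linarith
    field_simp; linarith
  have hD2 : (s + 1) ^ 2 * D ^ 2 = d ^ 2 := by rw [← f2]; ring
  rw [hK, f4]
  have goal : (2 * c - 4) * B + 0.82 * (|σ| * |d|) + 2.36
      ≤ S ^ 2 - D ^ 2 - (σ ^ 2 - d ^ 2) / 4 + 2 * s * (1 - s ^ 2) := by
    rw [← sq_abs σ, ← sq_abs d]
    rw [← sq_abs d] at hD2
    rw [← sq_abs σ] at hS2
    have hd0 := abs_nonneg d
    rcases le_total σ 0 with h | h
    · have hσa : σ = -|σ| := by rw [abs_of_nonpos h]; ring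
      have hs1' : s ≤ 1 := by
        by_contra hcon
        have : 0 < (s - 1) * S := mul_pos (by linarith) (by linarith)
        linarith
      have g3 : S ≤ B := by
        have : s * σ ≤ 0 := mul_nonpos_of_nonneg_of_nonpos hs0.le h
        linarith
      have f1' : (1 - s) * S = |σ| := by rw [hσa] at f1; linarith
      have hS2' : S ^ 2 = B ^ 2 - B * (s * |σ|) + s ^ 2 * |σ| ^ 2 / 4 := by
        rw [hS2]; nth_rewrite 1 [hσa]; ring
      have hu2 : |σ| ≤ 4 + 2 * δ := by rw [abs_of_nonpos h]; linarith
      rw [hS2']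
      exact two_iterates_bound_of_le_one (by linarith) hs1' (abs_nonneg σ) hd0 hσd hu2 (by linarith)
        (by linarith) g3 f1' hD2 hmain
    · have hs1' : 1 ≤ s := by
        by_contra hcon
        have : (s - 1) * S < 0 := mul_neg_of_neg_of_pos (by linarith) (by linarith)
        linarith
      have g3 : 0 ≤ B * (s * σ) := mul_nonneg (by linarith) (mul_nonneg hs0.le h)
      rw [hS2]
      have := two_iterates_bound_of_one_le hs1' (by linarith) (abs_nonneg σ) hd0 hσd hD2
        (by linarith) hmain
      linarith
  linarith

/-- Growth of a tangent vector of the invariant surface over two iterates of the trace map between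
values below the threshold. -/
theorem tangent_growth_two_iterates {c δ a m s l b y₀ ym y yl y₁ : ℝ} (hc : 8 < c) (hδ : 0 < δ)
    (hδc : δ * (100 * c) ≤ 1) (ha : |a| ≤ 2 + δ) (hs : |s| ≤ 2 + δ)
    (hb : |b| ≤ 2 + δ) (hl : l = s * m - a) (hbl : b = l * s - m)
    (hinv : m ^ 2 + s ^ 2 + a ^ 2 - m * s * a - 4 = c ^ 2)
    (htan : (2 * m - s * a) * ym = (m * a - 2 * s) * y + (m * s - 2 * a) * y₀)
    (hyl : yl = s * ym + m * y - y₀) (hy1 : y₁ = l * y + s * yl - ym)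
    (hy : (c - 1) * |y₀| ≤ |y|) :
    (2 * c - 4) * |y| ≤ |y₁| := by
  have hδ1 : δ ≤ 1 / 800 := by nlinarith
  have core : (2 * c - 4) * |2 * m - s * a| + |2 * l - s * b| / (c - 1)
      ≤ |4 * l * m - a * b + 2 * s * (1 - s ^ 2)| := by
    have hm0 : m ≠ 0 := by
      rintro rfl
      have := sq_abs s
      have := sq_abs a
      nlinarith [abs_nonneg s, abs_nonneg a]
    have hs0 : s ≠ 0 := by
      rintro rfl
      have : m = -b := by linarith
      have := sq_abs b
      have := sq_abs a
      subst m
      nlinarith [abs_nonneg b, abs_nonneg a]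
    -- Changing two of the signs of `a`, `m`, `s` preserves the invariant surface and the recursion
    -- up to the signs of `l` and `b`, so it is enough to treat `m, s > 0`.
    rcases lt_or_gt_of_ne hm0 with hm | hm <;> rcases lt_or_gt_of_ne hs0 with hs' | hs'
    · have := tangent_growth_two_iterates_of_pos (a := a) (m := -m) (s := -s) (l := l) (b := -b)
        hc hδ hδc (by linarith) (by linarith) ha (by rwa [abs_neg]) (by rwa [abs_neg])
        (by linarith) (by rw [hbl]; ring)
        (by linarith)
      rw [show 2 * -m - -s * a = -(2 * m - s * a) by ring, abs_neg,
        show 2 * l - -s * -b = 2 * l - s * b by ring] at this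
      refine this.trans ((le_of_eq (by ring)).trans (neg_le_abs _))
    · have := tangent_growth_two_iterates_of_pos (a := -a) (m := -m) (s := s) (l := -l) (b := -b)
        hc hδ hδc (by linarith) hs' (by rwa [abs_neg]) hs (by rwa [abs_neg])
        (by rw [hl]; ring) (by rw [hbl]; ring)
        (by linarith)
      rw [show 2 * -m - s * -a = -(2 * m - s * a) by ring, abs_neg,
        show 2 * -l - s * -b = -(2 * l - s * b) by ring, abs_neg] at this
      refine this.trans ((le_of_eq (by ring)).trans (le_abs_self _))
    · have := tangent_growth_two_iterates_of_pos (a := -a) (m := m) (s := -s) (l := -l) (b := b)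
        hc hδ hδc hm (by linarith) (by rwa [abs_neg]) (by rwa [abs_neg]) hb (by rw [hl]; ring)
        (by rw [hbl]; ring) (by linarith)
      rw [show 2 * m - -s * -a = 2 * m - s * a by ring,
        show 2 * -l - -s * b = -(2 * l - s * b) by ring, abs_neg] at this
      refine this.trans ((le_of_eq (by ring)).trans (neg_le_abs _))
    · exact (tangent_growth_two_iterates_of_pos hc hδ hδc hm hs' ha hs hb hl hbl hinv).trans
        (le_abs_self _)
  obtain ⟨hRl, hRu⟩ := markov_root_bounds hc hδ hδc hs ha hinv
  have hR0 : 0 < |2 * m - s * a| := by linarith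
  have key : (2 * m - s * a) * y₁
      = (4 * l * m - a * b + 2 * s * (1 - s ^ 2)) * y - (2 * l - s * b) * y₀ := by
    have e : (2 * m - s * a) * y₁ = (2 * m - s * a) * (l + s * m) * y
        + (s ^ 2 - 1) * ((2 * m - s * a) * ym) - (2 * m - s * a) * s * y₀ := by
      rw [hy1, hyl]; ring
    rw [e, htan, hbl, hl]; ring
  refine le_of_mul_le_mul_left ?_ hR0
  rw [← abs_mul _ y₁, key]
  have h1 := abs_sub_abs_le_abs_sub ((4 * l * m - a * b + 2 * s * (1 - s ^ 2)) * y)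
    ((2 * l - s * b) * y₀)
  rw [abs_mul, abs_mul _ y₀] at h1
  have h2 := mul_le_mul_of_nonneg_right core (abs_nonneg y)
  have h3 : |2 * l - s * b| * |y₀| ≤ |2 * l - s * b| / (c - 1) * |y| := by
    have hc1 : c - 1 ≠ 0 := by linarith
    calc |2 * l - s * b| * |y₀| = |2 * l - s * b| / (c - 1) * ((c - 1) * |y₀|) := by
          field_simp
      _ ≤ _ := mul_le_mul_of_nonneg_left hy (div_nonneg (abs_nonneg _) (by linarith))
  linarith

/-! ### Escape along the trace map -/

/-- Along the trace map, two consecutive values beyond the threshold that are not dominated by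
their predecessor escape super-exponentially. -/
theorem traceMap_escape {𝕜 : Type*} [NormedField 𝕜] {x : ℕ → 𝕜}
    (hx : ∀ k, x (k + 3) = x (k + 2) * x (k + 1) - x k) {δ : ℝ} (hδ : 0 < δ) {j : ℕ}
    (h0 : ‖x j‖ ≤ max ‖x (j + 1)‖ ‖x (j + 2)‖) (h1 : 2 + δ < ‖x (j + 1)‖)
    (h2 : 2 + δ < ‖x (j + 2)‖) (n : ℕ) :
    2 + δ < ‖x (j + 1 + n)‖ ∧ (1 + δ) ^ Nat.fib n ≤ ‖x (j + 1 + n)‖ - 1 := by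
  -- For `p, q ≥ 2` one has `pq - max p q ≥ (p - 1)(q - 1) + 1`, so `|x| - 1` is
  -- super-multiplicative along the orbit; this produces Fibonacci exponents.
  have step : ∀ i, ‖x i‖ ≤ max ‖x (i + 1)‖ ‖x (i + 2)‖ → 2 + δ < ‖x (i + 1)‖ →
      2 + δ < ‖x (i + 2)‖ → (‖x (i + 2)‖ - 1) * (‖x (i + 1)‖ - 1) ≤ ‖x (i + 3)‖ - 1 ∧
        max ‖x (i + 1)‖ ‖x (i + 2)‖ < ‖x (i + 3)‖ := by
    intro i h0 h1 h2
    have h3 : ‖x (i + 2)‖ * ‖x (i + 1)‖ - ‖x i‖ ≤ ‖x (i + 3)‖ := by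
      rw [hx, ← norm_mul]
      exact norm_sub_norm_le _ _
    rcases le_total ‖x (i + 1)‖ ‖x (i + 2)‖ with h | h
    · rw [max_eq_right h] at h0 ⊢
      constructor <;> nlinarith
    · rw [max_eq_left h] at h0 ⊢
      constructor <;> nlinarith
  have inv : ∀ n, ‖x (j + n)‖ ≤ max ‖x (j + n + 1)‖ ‖x (j + n + 2)‖ ∧
      2 + δ < ‖x (j + n + 1)‖ ∧ 2 + δ < ‖x (j + n + 2)‖ := by
    intro n
    induction n with
    | zero => exact ⟨h0, h1, h2⟩
    | succ n ih =>
      have h := (step _ ih.1 ih.2.1 ih.2.2).2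
      have h' := max_lt_iff.1 h
      refine ⟨le_max_of_le_right ?_, ih.2.2, ?_⟩
      · exact h'.1.le
      · exact ih.2.2.trans h'.2
  have grow : ∀ n, (1 + δ) ^ Nat.fib n ≤ ‖x (j + n + 1)‖ - 1 ∧
      (1 + δ) ^ Nat.fib (n + 1) ≤ ‖x (j + n + 2)‖ - 1 := by
    intro n
    induction n with
    | zero => simp only [Nat.fib_zero, pow_zero, zero_add, Nat.fib_one, pow_one, add_zero]
              constructor <;> linarith
    | succ n ih =>
      refine ⟨ih.2, ?_⟩
      have h := (step _ (inv n).1 (inv n).2.1 (inv n).2.2).1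
      refine le_trans ?_ h
      rw [show n + 1 + 1 = n + 2 from rfl, Nat.fib_add_two, pow_add, mul_comm]
      exact mul_le_mul ih.2 ih.1 (by positivity) (by linarith [(inv n).2.2])
  rw [show j + 1 + n = j + n + 1 by ring]
  exact ⟨(inv n).2.1, (grow n).1⟩

/-- Domination has to be assumed only at the start of the orbit. Going back to the first pair of a
run of large values, the value just before it is below the threshold and hence dominated. -/
theorem traceMap_escape_of_pair {𝕜 : Type*} [NormedField 𝕜] {x : ℕ → 𝕜}
    (hx : ∀ k, x (k + 3) = x (k + 2) * x (k + 1) - x k) {δ : ℝ} (hδ : 0 < δ)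
    (h0 : 2 + δ < ‖x 1‖ → 2 + δ < ‖x 2‖ → ‖x 0‖ ≤ max ‖x 1‖ ‖x 2‖) {j : ℕ}
    (h1 : 2 + δ < ‖x (j + 1)‖) (h2 : 2 + δ < ‖x (j + 2)‖) (n : ℕ) :
    2 + δ < ‖x (j + 1 + n)‖ ∧ (1 + δ) ^ Nat.fib n ≤ ‖x (j + 1 + n)‖ - 1 := by
  induction j generalizing n with
  | zero => exact traceMap_escape hx hδ (h0 h1 h2) h1 h2 n
  | succ j ih =>
    by_cases h : 2 + δ < ‖x (j + 1)‖
    · have := ih h h1 (n + 1)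
      rw [show j + 1 + (n + 1) = j + 1 + 1 + n by ring] at this
      refine ⟨this.1, le_trans ?_ this.2⟩
      exact pow_le_pow_right₀ (by linarith) (Nat.fib_mono (Nat.le_succ n))
    · exact traceMap_escape hx hδ (le_max_of_le_left ((not_lt.1 h).trans h1.le)) h1 h2 n

/-! ### Lower bound for the energy derivative of the traces -/

section RealTraces

variable {l1 l2 c δ w E : ℝ} {x y : ℕ → ℝ}

/-- The real trace map orbit at energy `E` together with its energy derivative. -/
structure TraceOrbit (l1 l2 E : ℝ) (x y : ℕ → ℝ) : Prop where
  x0 : x 0 = l1 / l2 + l2 / l1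
  x1 : x 1 = E / l2
  x2 : x 2 = E / l1
  y0 : y 0 = 0
  y1 : y 1 = 1 / l2
  y2 : y 2 = 1 / l1
  hx : ∀ k, x (k + 3) = x (k + 2) * x (k + 1) - x k
  hy : ∀ k, y (k + 3) = y (k + 2) * x (k + 1) + x (k + 2) * y (k + 1) - y k

theorem TraceOrbit.invariant (h : TraceOrbit l1 l2 E x y) (hl1 : 0 < l1) (hl2 : 0 < l2)
    (hc : c = (l1 ^ 2 - l2 ^ 2) / (l1 * l2)) (k : ℕ) :
    x k ^ 2 + x (k + 1) ^ 2 + x (k + 2) ^ 2 - x k * x (k + 1) * x (k + 2) - 4 = c ^ 2 := by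
  induction k with
  | zero =>
    simp only [zero_add]
    rw [h.x0, h.x1, h.x2, hc]; field_simp; ring
  | succ k ih => rw [h.hx k]; linear_combination ih

/-- The energy derivative of the invariant: its value `c²` does not depend on the energy, so the
derivatives form a tangent vector of the surface. -/
theorem TraceOrbit.tangent (h : TraceOrbit l1 l2 E x y) (hl1 : 0 < l1) (hl2 : 0 < l2) (k : ℕ) :
    (2 * x k - x (k + 1) * x (k + 2)) * y k + (2 * x (k + 1) - x k * x (k + 2)) * y (k + 1)
      + (2 * x (k + 2) - x k * x (k + 1)) * y (k + 2) = 0 := by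
  induction k with
  | zero =>
    simp only [zero_add]
    rw [h.x0, h.x1, h.x2, h.y0, h.y1, h.y2]; field_simp; ring
  | succ k ih => rw [h.hx k, h.hy k]; linear_combination ih

/-- Two consecutive large values would escape and make `x K` large. The start of the orbit is
dominated since, for `r = l1 / l2 ≥ 1` and `|x 2| > 2`, `x 0 = r + 1/r ≤ 2r < |x 1|`. -/
theorem TraceOrbit.not_pair (h : TraceOrbit l1 l2 E x y) (hl1 : 0 < l1) (hl2 : 0 < l2)
    (hl : l2 ≤ l1) (hδ : 0 < δ) {K : ℕ} (hK : |x K| ≤ 2 + δ) {j : ℕ} (hj : j + 1 ≤ K) :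
    |x (j + 1)| ≤ 2 + δ ∨ |x (j + 2)| ≤ 2 + δ := by
  by_contra! hcon
  obtain ⟨n, rfl⟩ := Nat.exists_eq_add_of_le hj
  refine absurd hK (not_le.2 (traceMap_escape_of_pair h.hx hδ ?_ hcon.1 hcon.2 n).1)
  intro _ h2
  apply le_max_of_le_left
  simp only [Real.norm_eq_abs] at *
  have e1 : x 1 = l1 / l2 * x 2 := by rw [h.x1, h.x2]; field_simp
  have r1 : 1 ≤ l1 / l2 := (one_le_div hl2).2 hl
  have r2 : l2 / l1 ≤ 1 := (div_le_one hl1).2 hl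
  rw [e1, abs_mul, abs_of_pos (by positivity : 0 < l1 / l2), h.x0, abs_of_pos (by positivity)]
  nlinarith

/-- Three values of size about 2 keep the left side of the invariant below 21, whereas `c² > 64`. -/
theorem TraceOrbit.not_triple (h : TraceOrbit l1 l2 E x y) (hl1 : 0 < l1) (hl2 : 0 < l2)
    (hc : c = (l1 ^ 2 - l2 ^ 2) / (l1 * l2)) (hc8 : 8 < c) (hδ1 : δ ≤ 1 / 800) {k : ℕ}
    (h0 : |x k| ≤ 2 + δ) (h1 : |x (k + 1)| ≤ 2 + δ) : 2 + δ < |x (k + 2)| := by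
  by_contra! h2
  have inv := h.invariant hl1 hl2 hc k
  have e : ∀ a : ℝ, |a| ≤ 2 + δ → a ^ 2 ≤ 5 := by
    intro a ha
    rw [← sq_abs]
    nlinarith [abs_nonneg a]
  have e3 : |x k * x (k + 1) * x (k + 2)| ≤ 2.1 * 2.1 * 2.1 := by
    rw [abs_mul, abs_mul]
    have : ∀ a : ℝ, |a| ≤ 2 + δ → |a| ≤ 2.1 := fun a ha => by linarith
    gcongr <;> exact this _ ‹_›
  have := (abs_le.1 e3).1
  have := e _ h0
  have := e _ h1
  have := e _ h2
  nlinarith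

/-- The two ways an orbit can be below the threshold at time `k`, with the size of the derivative:
directly after a small value, or after a large value preceded by a small one. -/
def SmallState (c δ w C : ℝ) (x y : ℕ → ℝ) (k : ℕ) : Prop :=
  (|x (k + 2)| ≤ 2 + δ ∧ (c - 1) * |y (k + 2)| ≤ |y (k + 3)| ∧
    C * w ^ (k + 5) ≤ (c - 1) * |y (k + 3)|) ∨
  (2 + δ < |x (k + 2)| ∧ |x (k + 1)| ≤ 2 + δ ∧ (c - 1) * |y (k + 1)| ≤ |y (k + 3)| ∧
    C * w ^ (k + 3) ≤ |y (k + 3)|)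

/-- With `r = l1 / l2`, `x 3 = r (x 2)² - (r + 1/r)`. Smallness of `x 3` keeps `x 2` away from 0,
the zero of the factor `2 r x 2` relating `y 3` to `y 2`. -/
theorem TraceOrbit.base_three (h : TraceOrbit l1 l2 E x y) (hl1 : 0 < l1) (hl2 : 0 < l2)
    (hc : c = (l1 ^ 2 - l2 ^ 2) / (l1 * l2)) (hc8 : 8 < c) (hδ1 : δ ≤ 1 / 800)
    (h3 : |x 3| ≤ 2 + δ) : (c - 1) * |y 2| ≤ |y 3| := by
  obtain ⟨r, hr⟩ : ∃ r, r = l1 / l2 := ⟨_, rfl⟩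
  have hr0 : 0 < r := hr ▸ div_pos hl1 hl2
  have hcr : c = r - 1 / r := by rw [hc, hr]; field_simp
  have hr8 : 8 < r := by
    have : 0 < 1 / r := by positivity
    linarith
  have hx3 : x 3 = r * x 2 ^ 2 - (r + 1 / r) := by
    rw [h.hx 0, h.x0, h.x1, h.x2, hr]; field_simp
  have hy3 : y 3 = 2 * r * x 2 * y 2 := by
    rw [h.hy 0, h.y0, h.x1, h.x2, h.y1, h.y2, hr]; field_simp; ring
  rw [hy3, abs_mul]
  refine mul_le_mul_of_nonneg_right ?_ (abs_nonneg _)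
  rw [hx3] at h3
  have h4 : 0.7 ≤ x 2 ^ 2 := by
    have := (abs_le.1 h3).1
    have h5 : 0 < 1 / r := by positivity
    nlinarith
  rw [abs_mul, abs_of_pos (by positivity : 0 < 2 * r)]
  have h6 : 0.5 ≤ |x 2| := by
    rw [← sq_abs] at h4
    nlinarith [abs_nonneg (x 2)]
  have : 0 < 1 / r := by positivity
  nlinarith

/-- `x 4` is `r` times a cubic in `x 2`. Where the cubic is at most `0.26` in modulus, `x 2` is away
from the critical points and the derivative of the cubic is at least 1. -/
theorem TraceOrbit.base_four (h : TraceOrbit l1 l2 E x y) (hl1 : 0 < l1) (hl2 : 0 < l2)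
    (hc : c = (l1 ^ 2 - l2 ^ 2) / (l1 * l2)) (hc8 : 8 < c) (hδ1 : δ ≤ 1 / 800)
    (h4 : |x 4| ≤ 2 + δ) : (c - 1) * |y 2| ≤ |y 4| := by
  obtain ⟨r, hr⟩ : ∃ r, r = l1 / l2 := ⟨_, rfl⟩
  have hr0 : 0 < r := hr ▸ div_pos hl1 hl2
  have hcr : c = r - 1 / r := by rw [hc, hr]; field_simp
  have hr8 : 8 < r := by
    have : 0 < 1 / r := by positivity
    linarith
  have hq : (1 / r) ^ 2 ≤ 1 / 64 := by
    rw [div_pow, one_pow]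
    exact one_div_le_one_div_of_le (by norm_num) (by nlinarith)
  obtain ⟨q, hqe⟩ : ∃ q, q = (1 / r) ^ 2 := ⟨_, rfl⟩
  have hq0 : 0 ≤ q := hqe ▸ sq_nonneg _
  rw [← hqe] at hq
  have hx4 : x 4 = r * (x 2 * (x 2 ^ 2 - 2 - q)) := by
    rw [h.hx 1, h.hx 0, h.x0, h.x1, h.x2, hqe, hr]; field_simp; ring
  have hy4 : y 4 = r * (3 * x 2 ^ 2 - 2 - q) * y 2 := by
    rw [h.hy 1, h.hx 0, h.hy 0, h.x0, h.x1, h.y0, h.x2, h.y1, h.y2, hqe, hr]; field_simp; ring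
  rw [hy4, abs_mul]
  refine mul_le_mul_of_nonneg_right ?_ (abs_nonneg _)
  rw [abs_mul, abs_of_pos hr0]
  have hp : 0 < 1 / r := by positivity
  have hz : |x 2 * (x 2 ^ 2 - 2 - q)| ≤ 0.26 := by
    rw [hx4, abs_mul, abs_of_pos hr0] at h4
    nlinarith [abs_nonneg (x 2 * (x 2 ^ 2 - 2 - q))]
  have : 1 ≤ |3 * x 2 ^ 2 - 2 - q| := by
    rw [abs_mul] at hz
    by_contra! hcon
    obtain ⟨ha, hb⟩ := abs_lt.1 hcon
    have h5 : 0.5 ≤ |x 2| := by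
      have : 0.25 ≤ |x 2| ^ 2 := by rw [sq_abs]; linarith
      nlinarith [abs_nonneg (x 2)]
    have h6 : 0.9 ≤ |x 2 ^ 2 - 2 - q| := by
      rw [abs_of_neg (by linarith)]; linarith
    nlinarith
  nlinarith

/-- Induction over the small values of the orbit. The weights in `SmallState` are offset: after a
large value the derivative is at least `C w^(k+3)`, directly after a small one only `C w^(k+5) / (c
- 1)`. That debt is repaid by the factor `c - 1` of the next passage, which spans two indices. Hence
a three-index cycle needs only `(c - 1)² ≥ w³`, and a two-index passage needs `2c - 4 ≥ w²`. -/
theorem TraceOrbit.smallState (h : TraceOrbit l1 l2 E x y) (hl1 : 0 < l1) (hl2 : 0 < l2)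
    (hl : l2 ≤ l1) (hc : c = (l1 ^ 2 - l2 ^ 2) / (l1 * l2)) (hc8 : 8 < c) (hδ : 0 < δ)
    (hδc : δ * (100 * c) ≤ 1) (hw1 : 1 ≤ w) (hw2 : w ^ 2 ≤ 2 * c - 4)
    (hw3 : w ^ 3 ≤ (c - 1) ^ 2) {K : ℕ} (hK : |x K| ≤ 2 + δ) (k : ℕ) (hk : k + 3 ≤ K)
    (hxk : |x (k + 3)| ≤ 2 + δ) : SmallState c δ w (1 / (l1 * w ^ 5)) x y k := by
  have hδ1 : δ ≤ 1 / 800 := by nlinarith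
  obtain ⟨C, hC⟩ : ∃ C, C = 1 / (l1 * w ^ 5) := ⟨_, rfl⟩
  have hw0 : 0 < w := by linarith
  have hC0 : 0 ≤ C := by rw [hC]; positivity
  have hCy : C * w ^ 5 = |y 2| := by
    rw [hC, h.y2, abs_of_pos (by positivity)]; field_simp
  have hCy4 : C * w ^ 3 ≤ |y 2| ∧ C * w ^ 4 ≤ |y 2| := by
    rw [← hCy]
    constructor <;> exact mul_le_mul_of_nonneg_left (pow_le_pow_right₀ hw1 (by norm_num)) hC0
  rw [← hC]
  induction k using Nat.strong_induction_on with
  | _ k ih =>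
  have np : ∀ j, j + 1 ≤ K → |x (j + 1)| ≤ 2 + δ ∨ |x (j + 2)| ≤ 2 + δ :=
    fun j hj => h.not_pair hl1 hl2 hl hδ hK hj
  match k, ih, hk, hxk with
  | 0, _, hk, hxk =>
    left
    have b := h.base_three hl1 hl2 hc hc8 hδ1 hxk
    refine ⟨?_, b, ?_⟩
    · by_contra! hcon
      have e1 : x 1 = l1 / l2 * x 2 := by rw [h.x1, h.x2]; field_simp
      have r1 : 1 ≤ l1 / l2 := (one_le_div hl2).2 hl
      have : 2 + δ < |x 1| := by
        rw [e1, abs_mul, abs_of_pos (by positivity : 0 < l1 / l2)]; nlinarith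
      rcases np 0 (by omega) with h' | h' <;> linarith
    · simp only [zero_add]
      rw [hCy]
      have e1 := mul_le_mul_of_nonneg_right (by linarith : 1 ≤ c - 1) (abs_nonneg (y 2))
      have e2 := mul_le_mul_of_nonneg_right (by linarith : 1 ≤ c - 1) (abs_nonneg (y 3))
      linarith
  | 1, _, hk, hxk =>
    have h3 : 2 + δ < |x 3| := by
      by_contra! h3
      have h2 : |x 2| ≤ 2 + δ := by
        by_contra! hcon
        have e1 : x 1 = l1 / l2 * x 2 := by rw [h.x1, h.x2]; field_simp
        have r1 : 1 ≤ l1 / l2 := (one_le_div hl2).2 hl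
        have : 2 + δ < |x 1| := by
          rw [e1, abs_mul, abs_of_pos (by positivity : 0 < l1 / l2)]; nlinarith
        rcases np 0 (by omega) with h' | h' <;> linarith
      exact absurd hxk (not_le.2 (h.not_triple hl1 hl2 hc hc8 hδ1 h2 h3))
    right
    have b := h.base_four hl1 hl2 hc hc8 hδ1 hxk
    refine ⟨h3, (np 1 (by omega)).resolve_right (not_le.2 h3), b, ?_⟩
    have := abs_nonneg (y 2)
    refine hCy4.2.trans (le_trans ?_ b)
    nlinarith
  | k + 2, ih, hk, hxk =>
    by_cases h4 : |x (k + 4)| ≤ 2 + δ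
    · -- directly after a small value
      have h3 : 2 + δ < |x (k + 3)| := by
        by_contra! h3
        exact absurd hxk (not_le.2 (h.not_triple hl1 hl2 hc hc8 hδ1 h3 h4))
      have h2 : |x (k + 2)| ≤ 2 + δ := (np (k + 1) (by omega)).resolve_right (not_le.2 h3)
      rcases ih (k + 1) (by omega) (by omega) h4 with h' | ⟨-, -, hr, hW⟩
      · exact absurd h'.1 (not_le.2 h3)
      · left
        have inv := h.invariant hl1 hl2 hc (k + 2)
        have tan := h.tangent hl1 hl2 (k + 2)
        have st := tangent_growth_one_iterate (s₀ := x (k + 2)) (s := x (k + 4)) (m := x (k + 3))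
          (s₁ := x (k + 5)) (y₀ := y (k + 2)) (y := y (k + 4)) (ym := y (k + 3)) (y₁ := y (k + 5))
          hc8 hδ hδc h2 h4
          hxk (by rw [h.hx (k + 2)]; ring) (by linear_combination inv)
          (by linear_combination tan) (by rw [h.hy (k + 2)]; ring) hr
        refine ⟨h4, st, ?_⟩
        have e1 : (c - 1) * ((c - 1) * |y (k + 4)|) ≤ (c - 1) * |y (k + 5)| :=
          mul_le_mul_of_nonneg_left st (by linarith)
        refine le_trans ?_ e1
        calc C * w ^ (k + 2 + 5) = w ^ 3 * (C * w ^ (k + 1 + 3)) := by ring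
          _ ≤ (c - 1) ^ 2 * |y (k + 4)| := mul_le_mul hw3 hW (by positivity) (sq_nonneg _)
          _ = _ := by ring
    · have h4' := not_le.1 h4
      have h3 : |x (k + 3)| ≤ 2 + δ := (np (k + 2) (by omega)).resolve_right h4
      right
      rcases ih k (by omega) (by omega) h3 with ⟨h2, hr, hW⟩ | ⟨h2, h1, hr, hW⟩
      · have inv := h.invariant hl1 hl2 hc (k + 2)
        have tan := h.tangent hl1 hl2 (k + 2)
        have st := tangent_growth_one_iterate (s₀ := x (k + 2)) (s := x (k + 3)) (m := x (k + 4))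
          (s₁ := x (k + 5)) (y₀ := y (k + 2)) (y := y (k + 3)) (ym := y (k + 4)) (y₁ := y (k + 5))
          hc8 hδ hδc h2 h3
          hxk (by rw [h.hx (k + 2)]) (by linear_combination inv)
          (by linear_combination tan) (by rw [h.hy (k + 2)]; ring) hr
        exact ⟨h4', h3, st, hW.trans st⟩
      · have inv := h.invariant hl1 hl2 hc (k + 1)
        have tan := h.tangent hl1 hl2 (k + 1)
        have st := tangent_growth_two_iterates (a := x (k + 1)) (s := x (k + 3)) (m := x (k + 2))
          (l := x (k + 4)) (b := x (k + 5)) (y₀ := y (k + 1)) (y := y (k + 3)) (ym := y (k + 2))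
          (yl := y (k + 4))
          (y₁ := y (k + 5))
          hc8 hδ hδc h1 h3
          hxk (by rw [h.hx (k + 1)]) (by rw [h.hx (k + 2)]) (by linear_combination inv)
          (by linear_combination tan) (by rw [h.hy (k + 1)]; ring) (by rw [h.hy (k + 2)]; ring) hr
        refine ⟨h4', h3, le_trans ?_ st, le_trans ?_ st⟩
        · exact mul_le_mul_of_nonneg_right (by linarith) (abs_nonneg _)
        · calc C * w ^ (k + 2 + 3) = w ^ 2 * (C * w ^ (k + 3)) := by ring
            _ ≤ _ := mul_le_mul hw2 hW (by positivity) (by linarith)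

/-- Lower bound for the energy derivative of the traces where they are below the threshold. -/
theorem TraceOrbit.deriv_lower_bound (h : TraceOrbit l1 l2 E x y) (hl1 : 0 < l1) (hl2 : 0 < l2)
    (hl : l2 ≤ l1) (hc : c = (l1 ^ 2 - l2 ^ 2) / (l1 * l2)) (hc8 : 8 < c) (hδ : 0 < δ)
    (hδc : δ * (100 * c) ≤ 1) (hw1 : 1 ≤ w) (hw2 : w ^ 2 ≤ 2 * c - 4) (hwc : c - 1 ≤ w ^ 2)
    (hw3 : w ^ 3 ≤ (c - 1) ^ 2) {k : ℕ} (hk : 2 ≤ k) (hxk : |x k| ≤ 2 + δ) :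
    1 / (l1 * w ^ 5) * w ^ k ≤ |y k| := by
  have hw0 : 0 < w := by linarith
  obtain rfl | hk3 := hk.eq_or_lt
  · rw [h.y2, abs_of_pos (by positivity), one_div, one_div, mul_inv, mul_assoc]
    refine mul_le_of_le_one_right (by positivity) ?_
    rw [inv_mul_le_one₀ (by positivity)]
    exact pow_le_pow_right₀ hw1 (by norm_num)
  · obtain ⟨n, rfl⟩ := Nat.exists_eq_add_of_le' (show 3 ≤ k from hk3)
    rcases h.smallState hl1 hl2 hl hc hc8 hδ hδc hw1 hw2 hw3 hxk n le_rfl hxk with h' | h'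
    · have h5 := h'.2.2
      refine le_of_mul_le_mul_left (le_trans ?_ h5) (by linarith : 0 < c - 1)
      calc (c - 1) * (1 / (l1 * w ^ 5) * w ^ (n + 3))
          ≤ w ^ 2 * (1 / (l1 * w ^ 5) * w ^ (n + 3)) :=
            mul_le_mul_of_nonneg_right hwc (by positivity)
        _ = _ := by ring
    · exact h'.2.2.2

end RealTraces

/-! ### From slopes on the real line to strips in the complex plane -/

theorem exists_lt_right_of_deriv_neg {f : ℝ → ℝ} {f' E y : ℝ} (hf : HasDerivAt f f' E)
    (h : f' < 0) (hy : E < y) : ∃ x ∈ Set.Ioo E y, f x < f E := by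
  have h1 : ∀ᶠ x in nhdsWithin E (Set.Ioi E), slope f E x < 0 :=
    ((hasDerivAt_iff_tendsto_slope.1 hf).mono_left
      (nhdsWithin_mono _ fun x hx => ne_of_gt hx)).eventually_lt_const h
  obtain ⟨x, hx, hx'⟩ := (h1.and (Ioo_mem_nhdsGT hy)).exists
  refine ⟨x, hx', ?_⟩
  rw [slope_def_field, div_neg_iff] at hx
  rcases hx with ⟨_, h2⟩ | ⟨h2, _⟩ <;> linarith [hx'.1]

/-- While `f` stays positive to the right of `E`, it keeps decreasing at rate at least `Λ`. Indeed
the minimum over such a stretch has `|f'| ≥ Λ`, so it is not interior, and it is not at `E`; thus it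
sits at the right end. This needs no continuity of `f'`. Hence `f` vanishes no later than `E + f(E)
/ Λ`. -/
theorem exists_root_right {f f' : ℝ → ℝ} (hf : ∀ x, HasDerivAt f (f' x) x) {Λ B E : ℝ}
    (hΛ : 0 < Λ) (hf' : ∀ x, |f x| ≤ B → Λ ≤ |f' x|) (hE : 0 < f E) (hEB : f E ≤ B)
    (hE' : f' E < 0) : ∃ r, f r = 0 ∧ Λ * |E - r| ≤ |f E| := by
  have hcont : Continuous f := continuous_iff_continuousAt.2 fun x => (hf x).continuousAt
  have claim : ∀ y, E ≤ y → (∀ x ∈ Set.Icc E y, 0 < f x) → f' y ≤ -Λ := by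
    intro y hy hpos
    rcases hy.eq_or_lt with rfl | hlt
    · have := hf' E (by rwa [abs_of_pos hE])
      rw [abs_of_neg hE'] at this
      linarith
    obtain ⟨m, hm, hmin⟩ := isCompact_Icc.exists_isMinOn (Set.nonempty_Icc.2 hy)
      hcont.continuousOn
    have hmE : f m ≤ f E := hmin (Set.left_mem_Icc.2 hy)
    have hm' : Λ ≤ |f' m| := hf' m (by rw [abs_of_pos (hpos m hm)]; linarith)
    rcases eq_or_ne m E with rfl | hne
    · obtain ⟨x, hx, hxE⟩ := exists_lt_right_of_deriv_neg (hf m) hE' hlt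
      have := hmin (Set.Ioo_subset_Icc_self hx)
      exact absurd hxE (not_lt.2 this)
    have hEm : E < m := lt_of_le_of_ne hm.1 hne.symm
    rcases eq_or_ne m y with rfl | hne'
    · rcases abs_cases (f' m) with ⟨h, h2⟩ | ⟨h, h2⟩
      · have hg : HasDerivAt (fun x => f (-x)) (-f' m) (-m) := by
          have h3 : HasDerivAt f (f' m) (-(-m)) := by rw [neg_neg]; exact hf m
          have h4 := h3.comp (-m) (hasDerivAt_neg (-m))
          rw [mul_neg_one] at h4
          exact h4
        obtain ⟨x, hx, hxm⟩ := exists_lt_right_of_deriv_neg hg (by linarith)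
          (show -m < -E by linarith)
        rw [neg_neg] at hxm
        have := hmin (show -x ∈ Set.Icc E m from ⟨by linarith [hx.2], by linarith [hx.1]⟩)
        exact absurd hxm (not_lt.2 this)
      · linarith
    · have hlt' : m < y := lt_of_le_of_ne hm.2 hne'
      have : f' m = 0 := (hmin.isLocalMin (Icc_mem_nhds hEm hlt')).hasDerivAt_eq_zero (hf m)
      rw [this, abs_zero] at hm'
      linarith
  have mvt : ∀ y, E ≤ y → (∀ x ∈ Set.Ico E y, 0 < f x) → f y - f E ≤ -Λ * (y - E) := by
    intro y hy hpos
    refine (convex_Icc E y).image_sub_le_mul_sub_of_deriv_le hcont.continuousOn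
      (fun x _ => (hf x).differentiableAt.differentiableWithinAt) (fun x hx => ?_) E
      (Set.left_mem_Icc.2 hy) y (Set.right_mem_Icc.2 hy) hy
    rw [interior_Icc] at hx
    rw [(hf x).deriv]
    exact claim x hx.1.le fun z hz => hpos z ⟨hz.1, hz.2.trans_lt hx.2⟩
  obtain ⟨b, hb⟩ : ∃ b, b = E + f E / Λ := ⟨_, rfl⟩
  have hEb : E ≤ b := by rw [hb]; linarith [div_pos hE hΛ]
  have hbE : Λ * (b - E) = f E := by rw [hb]; field_simp; ring
  have hne : (Set.Icc E b ∩ {x | f x ≤ 0}).Nonempty := by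
    by_contra! hcon
    have hpos : ∀ x ∈ Set.Icc E b, 0 < f x := by
      intro x hx
      by_contra! h
      have : x ∈ Set.Icc E b ∩ {x | f x ≤ 0} := ⟨hx, h⟩
      rw [hcon] at this
      exact this
    have := mvt b hEb fun x hx => hpos x (Set.Ico_subset_Icc_self hx)
    linarith [hpos b (Set.right_mem_Icc.2 hEb)]
  obtain ⟨r, hr, hmin⟩ := (isCompact_Icc.inter_right
    (isClosed_le hcont continuous_const)).exists_isLeast hne
  have hpos : ∀ x ∈ Set.Ico E r, 0 < f x := by
    intro x hx
    by_contra! h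
    exact absurd (hmin ⟨⟨hx.1, hx.2.le.trans hr.1.2⟩, h⟩) (not_le.2 hx.2)
  have hr0 : f r = 0 := by
    refine le_antisymm hr.2 ?_
    by_contra! h
    obtain ⟨z, hz, hz0⟩ := intermediate_value_Icc' hr.1.1 hcont.continuousOn
      (show (0 : ℝ) ∈ Set.Icc (f r) (f E) from ⟨h.le, hE.le⟩)
    have : r ≤ z := hmin ⟨⟨hz.1, hz.2.trans hr.1.2⟩, hz0.le⟩
    have : z = r := le_antisymm hz.2 this
    rw [this] at hz0
    linarith
  refine ⟨r, hr0, ?_⟩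
  have := mvt r hr.1.1 hpos
  rw [abs_of_nonpos (by linarith [hr.1.1]), abs_of_pos hE]
  linarith

/-- If the slope of `f` is at least `Λ` wherever `|f| ≤ B`, then every point with `|f| ≤ B` is
close to a zero. -/
theorem exists_root_of_deriv_lower_bound {f f' : ℝ → ℝ} (hf : ∀ x, HasDerivAt f (f' x) x)
    {Λ B E : ℝ} (hΛ : 0 < Λ) (hf' : ∀ x, |f x| ≤ B → Λ ≤ |f' x|) (hEB : |f E| ≤ B) :
    ∃ r, f r = 0 ∧ Λ * |E - r| ≤ |f E| := by
  have key : ∀ g g' : ℝ → ℝ, (∀ x, HasDerivAt g (g' x) x) → (∀ x, |g x| ≤ B → Λ ≤ |g' x|) →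
      0 < g E → g E ≤ B → ∃ r, g r = 0 ∧ Λ * |E - r| ≤ |g E| := by
    intro g g' hg hg' hE hEB
    have h0 := hg' E (by rwa [abs_of_pos hE])
    rcases lt_trichotomy (g' E) 0 with h | h | h
    · exact exists_root_right hg hΛ hg' hE hEB h
    · rw [h, abs_zero] at h0; linarith
    · obtain ⟨r, hr, hr'⟩ := exists_root_right (f := fun x => g (-x)) (f' := fun x => -g' (-x))
        (E := -E) (B := B)
        (fun x => by
          have h4 := (hg (-x)).comp x (hasDerivAt_neg x)
          rw [mul_neg_one] at h4
          exact h4) hΛ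
        (fun x hx => by rw [abs_neg]; exact hg' (-x) hx) (by simpa using hE) (by simpa using hEB)
        (by simpa using h)
      refine ⟨-r, hr, ?_⟩
      simp only [neg_neg] at hr'
      rwa [show E - -r = -(-E - r) by ring, abs_neg]
  rcases lt_trichotomy (f E) 0 with h | h | h
  · obtain ⟨r, hr, hr'⟩ := key (fun x => -f x) (fun x => -f' x) (fun x => (hf x).neg)
      (fun x hx => by rw [abs_neg] at hx ⊢; exact hf' x hx) (by simpa using h)
      (by rw [abs_of_neg h] at hEB; exact hEB)
    refine ⟨r, by simpa using hr, by simpa using hr'⟩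
  · exact ⟨E, h, by simp⟩
  · exact key f f' hf hf' h (by rwa [abs_of_pos h] at hEB)

namespace Polynomial

/-- For a real-rooted polynomial, moving off the real axis increases the modulus. -/
theorem abs_eval_re_le_norm_aeval {q : Polynomial ℝ}
    (hq : ∀ z : ℂ, aeval z q = 0 → z.im = 0) (z : ℂ) : |q.eval z.re| ≤ ‖aeval z q‖ := by
  have hsplit := IsAlgClosed.splits (q.map (algebraMap ℝ ℂ))
  have h1 : ∀ v : ℂ, ‖aeval v q‖ = ‖(q.map (algebraMap ℝ ℂ)).leadingCoeff‖ *
      (((q.map (algebraMap ℝ ℂ)).roots.map fun r => ‖v - r‖).prod) := by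
    intro v
    rw [← eval_map_algebraMap, hsplit.eval_eq_prod_roots, norm_mul]
    congr 1
    generalize (q.map (algebraMap ℝ ℂ)).roots = R
    induction R using Multiset.induction_on with
    | empty => simp
    | cons a R ih => simp [ih]
  have h2 : |q.eval z.re| = ‖aeval (z.re : ℂ) q‖ := by
    rw [← Complex.coe_algebraMap, aeval_algebraMap_apply_eq_algebraMap_eval]
    simp
  rw [h2, h1, h1]
  refine mul_le_mul_of_nonneg_left ?_ (norm_nonneg _)
  -- All roots are real, so each factor satisfies `|Re z - r| ≤ |z - r|`.
  refine Multiset.prod_map_le_prod_map₀ _ _ (fun r _ => norm_nonneg _) fun r hr => ?_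
  have hr0 : r.im = 0 := by
    apply hq
    rw [← eval_map_algebraMap]
    exact isRoot_of_mem_roots hr
  have : (z.re : ℂ) - r = ((z.re - r.re : ℝ) : ℂ) := by
    apply Complex.ext <;> simp [hr0]
  rw [this, Complex.norm_real, Real.norm_eq_abs, ← Complex.sub_re]
  exact Complex.abs_re_le_norm _

/-- For a real-rooted polynomial whose slope is at least `Λ` wherever it is at most `B` in modulus,
the complex sublevel set `{|p| ≤ B}` lies in the strip `|Im z| ≤ B / Λ`. -/
theorem mul_abs_im_le_of_norm_aeval_le {p : Polynomial ℝ}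
    (hp : ∀ z : ℂ, aeval z p = 0 → z.im = 0) {Λ B : ℝ} (hΛ : 0 < Λ)
    (hd : ∀ x : ℝ, |p.eval x| ≤ B → Λ ≤ |p.derivative.eval x|) {z : ℂ}
    (hz : ‖aeval z p‖ ≤ B) : Λ * |z.im| ≤ B := by
  have hE := (abs_eval_re_le_norm_aeval hp z).trans hz
  obtain ⟨r, hr, hrE⟩ := exists_root_of_deriv_lower_bound (fun x => p.hasDerivAt x) hΛ hd hE
  obtain ⟨q, hq⟩ := dvd_iff_isRoot.2 hr
  have hqr : ∀ v : ℂ, aeval v q = 0 → v.im = 0 := fun v hv =>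
    hp v (by rw [hq, map_mul, hv, mul_zero])
  -- Divide out the nearby root `r`. Off `r` the bound is the distance estimate `Λ |Re z - r| ≤
  -- |p(Re z)|`; at `r` itself `q(r) = p'(r)`. The quotient is still real-rooted, so the bound
  -- persists at `z`, and the removed factor has modulus at least `|Im z|`.
  have hqE : Λ ≤ |q.eval z.re| := by
    by_cases h : z.re = r
    · have h2 := hd r (by rw [hr, abs_zero]; exact (abs_nonneg _).trans hE)
      rw [h]
      convert h2 using 2
      rw [hq]; simp
    · have h2 : 0 < |z.re - r| := abs_pos.2 (sub_ne_zero.2 h)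
      rw [hq, eval_mul, abs_mul, mul_comm] at hrE
      refine le_of_mul_le_mul_left (hrE.trans (le_of_eq ?_) |>.trans' (le_of_eq ?_)) h2
      · simp
      · ring
  refine le_trans ?_ hz
  rw [hq, map_mul, norm_mul, mul_comm]
  refine mul_le_mul ?_ (hqE.trans (abs_eval_re_le_norm_aeval hqr z)) hΛ.le (norm_nonneg _)
  have : (aeval z (X - C r)).im = z.im := by simp
  rw [← this]
  exact Complex.abs_im_le_norm _

end Polynomial

/-! ### Repetitions and reflection symmetry of the hopping sequence -/

/-- The inverse golden ratio `(√5 - 1) / 2`. -/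
noncomputable def goldenRotation : ℝ := (√5 - 1) / 2

theorem goldenRotation_eq : goldenRotation = -Real.goldenConj := by
  rw [goldenRotation, Real.goldenConj]; ring

theorem goldenRotation_pos : 0 < goldenRotation := by
  rw [goldenRotation_eq]; linarith [Real.goldenConj_neg]

theorem goldenRotation_lt_one : goldenRotation < 1 := by
  rw [goldenRotation_eq]; linarith [Real.neg_one_lt_goldenConj]

theorem fib_sub_goldenRotation_mul_fib (j : ℕ) :
    (Nat.fib (j + 1) : ℝ) * goldenRotation - Nat.fib j = -(Real.goldenConj ^ (j + 1)) := by
  rw [← Real.fib_succ_sub_goldenRatio_mul_fib (j + 1), Nat.fib_add_two, goldenRotation_eq]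
  have : Real.goldenRatio = 1 - Real.goldenConj := by linarith [Real.goldenRatio_add_goldenConj]
  rw [this]; push_cast; ring

theorem fib_cassini (j : ℕ) :
    (Nat.fib (j + 1) : ℤ) ^ 2 - Nat.fib j * Nat.fib (j + 2) = (-1) ^ j := by
  induction j with
  | zero => simp
  | succ j ih =>
    rw [pow_succ (-1 : ℤ) j, ← ih, Nat.fib_add_two (n := j + 1), Nat.fib_add_two (n := j)]
    push_cast; ring

/-- The Fibonacci numbers are the best denominators for the golden rotation: between `n β` and
`n β + (F_{j+1} β - F_j)` there is no integer when `0 < n < F_{j+2}`. -/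
theorem goldenRotation_no_crossing {j n : ℕ} (hn : 1 ≤ n) (hnj : n < Nat.fib (j + 2)) {m : ℤ}
    {θ : ℝ} (hθ : (m : ℝ) - n * goldenRotation
      = θ * ((Nat.fib (j + 1) : ℝ) * goldenRotation - Nat.fib j)) : ¬ (0 ≤ θ ∧ θ ≤ 1) := by
  rintro ⟨h0, h1⟩
  have cas := fib_cassini j
  -- `u` and `v` are the coordinates of `(n, m)` in the basis `(F_{j+1}, F_j)`, `(F_{j+2}, F_{j+1})`
  -- of `ℤ²`, unimodular by Cassini's identity.
  obtain ⟨u, hu⟩ : ∃ u : ℤ, u = (-1) ^ j * (n * Nat.fib (j + 1) - m * Nat.fib (j + 2)) := ⟨_, rfl⟩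
  obtain ⟨v, hv⟩ : ∃ v : ℤ, v = (-1) ^ j * (-n * Nat.fib j + m * Nat.fib (j + 1)) := ⟨_, rfl⟩
  have hsq : ((-1 : ℤ) ^ j) * (-1) ^ j = 1 := by rw [← mul_pow]; simp
  have en : (n : ℤ) = u * Nat.fib (j + 1) + v * Nat.fib (j + 2) := by
    rw [hu, hv]
    linear_combination -(n : ℤ) * hsq - (n : ℤ) * (-1) ^ j * cas
  have em : m = u * Nat.fib j + v * Nat.fib (j + 1) := by
    rw [hu, hv]
    linear_combination -m * hsq - m * (-1) ^ j * cas
  have hψ : Real.goldenConj ^ (j + 1) ≠ 0 := pow_ne_zero _ Real.goldenConj_ne_zero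
  have d0 := fib_sub_goldenRotation_mul_fib j
  have d1 := fib_sub_goldenRotation_mul_fib (j + 1)
  -- The approximation errors of the two basis vectors have ratio `-β`. Since `0 < n < F_{j+2}`
  -- forces `u` and `v` to have opposite signs, or `v = 0` and `u ≥ 1`, this expression lies outside
  -- `[0, 1]`.
  have hθ' : θ = goldenRotation * v - u := by
    have en' : (n : ℝ) = u * Nat.fib (j + 1) + v * Nat.fib (j + 2) := by exact_mod_cast en
    have em' : (m : ℝ) = u * Nat.fib j + v * Nat.fib (j + 1) := by exact_mod_cast em
    rw [d0, en', em'] at hθ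
    rw [goldenRotation_eq] at *
    apply mul_right_cancel₀ hψ
    rw [pow_succ _ (j + 1)] at d1
    linear_combination hθ + u * d0 + v * d1
  have hβ := goldenRotation_pos
  have F1 : (0 : ℤ) < Nat.fib (j + 1) := by exact_mod_cast Nat.fib_pos.2 (Nat.succ_pos j)
  have F2 : (0 : ℤ) < Nat.fib (j + 2) := by exact_mod_cast Nat.fib_pos.2 (Nat.succ_pos _)
  have hn' : (1 : ℤ) ≤ n := by exact_mod_cast hn
  have hnj' : (n : ℤ) < Nat.fib (j + 2) := by exact_mod_cast hnj
  rcases lt_trichotomy v 0 with h | h | h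
  · have hu1 : 1 ≤ u := by
      by_contra! hcon
      nlinarith
    have : (v : ℝ) < 0 := by exact_mod_cast h
    have : (1 : ℝ) ≤ u := by exact_mod_cast hu1
    nlinarith
  · subst h
    have hu1 : 1 ≤ u := by
      by_contra! hcon
      nlinarith
    have : (1 : ℝ) ≤ u := by exact_mod_cast hu1
    simp at hθ'
    linarith
  · have hu1 : u ≤ -1 := by
      by_contra! hcon
      nlinarith
    have : (1 : ℝ) ≤ v := by exact_mod_cast h
    have : (u : ℝ) ≤ -1 := by exact_mod_cast hu1
    nlinarith

theorem floor_add_fib_mul_goldenRotation {j n : ℕ} (hn : 1 ≤ n) (hnj : n < Nat.fib (j + 2)) :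
    ⌊((n + Nat.fib (j + 1) : ℕ) : ℝ) * goldenRotation⌋
      = ⌊(n : ℝ) * goldenRotation⌋ + Nat.fib j := by
  obtain ⟨d, hd⟩ : ∃ d, d = (Nat.fib (j + 1) : ℝ) * goldenRotation - Nat.fib j := ⟨_, rfl⟩
  have hd0 : d ≠ 0 := by
    rw [hd, fib_sub_goldenRotation_mul_fib]
    exact neg_ne_zero.2 (pow_ne_zero _ Real.goldenConj_ne_zero)
  have e : ((n + Nat.fib (j + 1) : ℕ) : ℝ) * goldenRotation
      = (n : ℝ) * goldenRotation + d + (Nat.fib j : ℤ) := by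
    rw [hd]; push_cast; ring
  rw [e, Int.floor_add_intCast, add_left_inj, Int.floor_eq_iff]
  have h1 := Int.floor_le ((n : ℝ) * goldenRotation)
  have h2 := Int.lt_floor_add_one ((n : ℝ) * goldenRotation)
  obtain ⟨f, hf⟩ : ∃ f, f = ⌊(n : ℝ) * goldenRotation⌋ := ⟨_, rfl⟩
  rw [← hf] at h1 h2 ⊢
  constructor
  · by_contra! hcon
    refine goldenRotation_no_crossing hn hnj (m := f) (θ := (f - n * goldenRotation) / d)
      (by rw [← hd]; field_simp) ⟨div_nonneg_of_nonpos (by linarith) (by linarith), ?_⟩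
    rw [div_le_one_of_neg (by linarith)]; linarith
  · by_contra! hcon
    refine goldenRotation_no_crossing hn hnj (m := f + 1)
      (θ := (((f + 1 : ℤ) : ℝ) - n * goldenRotation) / d)
      (by rw [← hd]; field_simp) ?_
    push_cast
    exact ⟨div_nonneg (by linarith) (by linarith), (div_le_one (by linarith)).2 (by linarith)⟩

variable {l1 l2 : ℝ}

/-- The floors at `n` and at `n + 1` both shift by `F_j`, whence the bound on `n + 1`. The
repetition covers a whole block of length `F_{j+1}` as soon as `j ≥ 3`. -/
theorem sturmianHopping_add_fib {j n : ℕ} (hn : 1 ≤ n) (hnj : n + 1 < Nat.fib (j + 2)) :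
    sturmianHopping l1 l2 goldenRotation ((n + Nat.fib (j + 1) : ℕ) : ℤ)
      = sturmianHopping l1 l2 goldenRotation (n : ℤ) := by
  have h1 := floor_add_fib_mul_goldenRotation hn (Nat.lt_of_succ_lt hnj)
  have h2 := floor_add_fib_mul_goldenRotation (j := j) (Nat.le_add_left 1 n) hnj
  rw [show n + 1 + Nat.fib (j + 1) = (n + Nat.fib (j + 1)) + 1 by ring] at h2
  push_cast at h1 h2
  unfold sturmianHopping
  push_cast
  rw [h1, h2]
  push_cast
  ring

/-- Irrationality gives `⌊-x⌋ = -⌊x⌋ - 1` at nonzero multiples of the rotation number. The left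
half-line thus carries the same hopping sequence as the right one. -/
theorem sturmianHopping_reflect {m : ℕ} (hm : 1 ≤ m) :
    sturmianHopping l1 l2 goldenRotation (-(m : ℤ) - 1)
      = sturmianHopping l1 l2 goldenRotation (m : ℤ) := by
  have key : ∀ n : ℕ, 1 ≤ n → ⌊-((n : ℝ) * goldenRotation)⌋ = -⌊(n : ℝ) * goldenRotation⌋ - 1 := by
    intro n hn
    have hirr : Irrational ((n : ℝ) * goldenRotation) := by
      rw [goldenRotation_eq]
      exact Real.goldenConj_irrational.neg.natCast_mul (by omega)
    have h1 := Int.floor_le ((n : ℝ) * goldenRotation)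
    have h2 := Int.lt_floor_add_one ((n : ℝ) * goldenRotation)
    have h3 : (⌊(n : ℝ) * goldenRotation⌋ : ℝ) ≠ (n : ℝ) * goldenRotation := (hirr.ne_int _).symm
    have h4 := lt_of_le_of_ne h1 h3
    rw [Int.floor_eq_iff]
    push_cast
    constructor <;> linarith
  have k1 := key m hm
  have k2 := key (m + 1) (by omega)
  unfold sturmianHopping
  push_cast at k2 ⊢
  rw [show (-(m : ℝ) - 1 + 1) * goldenRotation = -((m : ℝ) * goldenRotation) by ring,
    show (-(m : ℝ) - 1) * goldenRotation = -(((m : ℝ) + 1) * goldenRotation) by ring, k1, k2]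
  push_cast
  ring

theorem sturmianHopping_mem (n : ℤ) : sturmianHopping l1 l2 goldenRotation n = l1 ∨
    sturmianHopping l1 l2 goldenRotation n = l2 := by
  have h1 := Int.floor_le ((n : ℝ) * goldenRotation)
  have h2 := Int.lt_floor_add_one ((n : ℝ) * goldenRotation)
  have h3 := Int.floor_le (((n : ℝ) + 1) * goldenRotation)
  have h4 := Int.lt_floor_add_one (((n : ℝ) + 1) * goldenRotation)
  have hβ := goldenRotation_pos
  have hβ' := goldenRotation_lt_one
  have h5 : ⌊(n : ℝ) * goldenRotation⌋ < ⌊((n : ℝ) + 1) * goldenRotation⌋ + 1 := by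
    have : (⌊(n : ℝ) * goldenRotation⌋ : ℝ) < ⌊((n : ℝ) + 1) * goldenRotation⌋ + 1 := by linarith
    exact_mod_cast this
  have h6 : ⌊((n : ℝ) + 1) * goldenRotation⌋ < ⌊(n : ℝ) * goldenRotation⌋ + 2 := by
    have : (⌊((n : ℝ) + 1) * goldenRotation⌋ : ℝ) < ⌊(n : ℝ) * goldenRotation⌋ + 2 := by linarith
    exact_mod_cast this
  unfold sturmianHopping
  have h7 : ⌊((n : ℝ) + 1) * goldenRotation⌋ - ⌊(n : ℝ) * goldenRotation⌋ = 0 ∨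
    ⌊((n : ℝ) + 1) * goldenRotation⌋ - ⌊(n : ℝ) * goldenRotation⌋ = 1 := by omega
  rcases h7 with h | h <;> rw [h] <;> simp

theorem sturmianHopping_one : sturmianHopping l1 l2 goldenRotation 1 = l1 := by
  have e1 : ⌊goldenRotation⌋ = 0 :=
    Int.floor_eq_zero_iff.2 ⟨goldenRotation_pos.le, goldenRotation_lt_one⟩
  have e2 : ⌊2 * goldenRotation⌋ = 1 := by
    rw [Int.floor_eq_iff]
    have : (2 : ℝ) ≤ √5 := Real.le_sqrt_of_sq_le (by norm_num)
    have := goldenRotation_lt_one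
    unfold goldenRotation at *
    push_cast
    constructor <;> linarith
  unfold sturmianHopping
  norm_num [e1, e2]

theorem sturmianHopping_two : sturmianHopping l1 l2 goldenRotation 2 = l2 := by
  have h5 : (2 : ℝ) ≤ √5 := Real.le_sqrt_of_sq_le (by norm_num)
  have h6 : √5 < 2.3 := (Real.sqrt_lt' (by norm_num)).2 (by norm_num)
  have e1 : ⌊3 * goldenRotation⌋ = 1 := by
    rw [Int.floor_eq_iff]
    unfold goldenRotation
    push_cast
    constructor <;> linarith
  have e2 : ⌊2 * goldenRotation⌋ = 1 := by
    rw [Int.floor_eq_iff]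
    unfold goldenRotation
    push_cast
    constructor <;> linarith
  unfold sturmianHopping
  norm_num [e1, e2]

/-! ### Trace polynomials, transfer matrices and the current -/

/-- The trace polynomials, defined by the Fibonacci trace map recursion. -/
noncomputable def tracePoly (l1 l2 : ℝ) : ℕ → Polynomial ℝ
  | 0 => Polynomial.C (l1 / l2 + l2 / l1)
  | 1 => Polynomial.C (1 / l2) * Polynomial.X
  | 2 => Polynomial.C (1 / l1) * Polynomial.X
  | k + 3 => tracePoly l1 l2 (k + 2) * tracePoly l1 l2 (k + 1) - tracePoly l1 l2 k

theorem tracePoly_traceOrbit (l1 l2 E : ℝ) :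
    TraceOrbit l1 l2 E (fun k => (tracePoly l1 l2 k).eval E)
      (fun k => (tracePoly l1 l2 k).derivative.eval E) where
  x0 := by simp [tracePoly]
  x1 := by simp [tracePoly]; ring
  x2 := by simp [tracePoly]; ring
  y0 := by simp only [tracePoly, Polynomial.derivative_C, Polynomial.eval_zero]
  y1 := by simp [tracePoly]
  y2 := by simp [tracePoly]
  hx k := by simp [tracePoly]
  hy k := by simp [tracePoly]

/-- The `SL(2)` transfer matrix at energy `z` across a site with outgoing hopping `a`. -/
noncomputable def transferMatrix (z : ℂ) (a : ℝ) : Matrix (Fin 2) (Fin 2) ℂ :=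
  !![z / a, -1 / a; a, 0]

/-- The product of the transfer matrices over the sites `1, …, n`. -/
noncomputable def transferProd (a : ℕ → ℝ) (z : ℂ) : ℕ → Matrix (Fin 2) (Fin 2) ℂ
  | 0 => 1
  | n + 1 => transferMatrix z (a (n + 1)) * transferProd a z n

/-- The current `Im (u₀ conj u₁)` of a vector of `ℂ²`. -/
def current (U : Fin 2 → ℂ) : ℝ := (U 0 * (starRingEnd ℂ) (U 1)).im

/-- The current is conserved for real `z`; off the real axis each step changes it with the sign of
`Im z`. This yields both the real-rootedness of the traces and the decay on half-lines. -/
theorem current_transferMatrix (z : ℂ) {a : ℝ} (ha : a ≠ 0) (U : Fin 2 → ℂ) :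
    current ((transferMatrix z a).mulVec U) = current U + z.im * ‖U 0‖ ^ 2 := by
  have ha' : (a : ℂ) ≠ 0 := by exact_mod_cast ha
  have e : (z / a * U 0 + -1 / a * U 1) * (starRingEnd ℂ) (a * U 0)
      = (z * U 0 - U 1) * (starRingEnd ℂ) (U 0) := by
    rw [map_mul, Complex.conj_ofReal]; field_simp; ring
  simp only [current, transferMatrix, Matrix.mulVec, dotProduct, Fin.sum_univ_two, Matrix.of_apply,
    Matrix.cons_val_zero, Matrix.cons_val_one, zero_mul, add_zero]
  rw [e, ← Complex.normSq_eq_norm_sq, Complex.normSq_apply]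
  simp
  ring

theorem det_transferMatrix (z : ℂ) {a : ℝ} (ha : a ≠ 0) : (transferMatrix z a).det = 1 := by
  have ha' : (a : ℂ) ≠ 0 := by exact_mod_cast ha
  rw [transferMatrix, Matrix.det_fin_two_of]; field_simp; ring

section

variable {a : ℕ → ℝ} {z : ℂ}

theorem det_transferProd (ha : ∀ n, a n ≠ 0) (n : ℕ) : (transferProd a z n).det = 1 := by
  induction n with
  | zero => simp [transferProd]
  | succ n ih => rw [transferProd, Matrix.det_mul, ih, det_transferMatrix z (ha _), mul_one]

theorem current_transferProd (ha : ∀ n, a n ≠ 0) (U : Fin 2 → ℂ) (n : ℕ) :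
    current ((transferProd a z n).mulVec U)
      = current U + z.im * ∑ i ∈ Finset.range n, ‖(transferProd a z i).mulVec U 0‖ ^ 2 := by
  induction n with
  | zero => simp [transferProd]
  | succ n ih =>
    rw [transferProd, ← Matrix.mulVec_mulVec, current_transferMatrix z (ha _), ih,
      Finset.sum_range_succ]
    ring

theorem transferProd_add {F m : ℕ} (h : ∀ i, 1 ≤ i → i ≤ m → a (i + F) = a i) :
    transferProd a z (m + F) = transferProd a z m * transferProd a z F := by
  induction m with
  | zero => simp [transferProd]
  | succ m ih =>
    rw [show m + 1 + F = (m + F) + 1 by ring, transferProd, transferProd,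
      ih fun i h1 h2 => h i h1 (h2.trans (Nat.le_succ m)), Matrix.mul_assoc,
      show m + F + 1 = m + 1 + F by ring, h (m + 1) (by omega) le_rfl]

end

theorem Matrix.sq_eq_of_det_eq_one {M : Matrix (Fin 2) (Fin 2) ℂ} (h : M.det = 1) :
    M * M = M.trace • M - 1 := by
  rw [Matrix.det_fin_two] at h
  ext i j
  fin_cases i <;> fin_cases j <;>
    simp [Matrix.mul_apply, Matrix.trace_fin_two, Fin.sum_univ_two] <;>
    first | ring1 | linear_combination (-1 : ℂ) * h

/-- Zero trace means `M² = -1` by Cayley-Hamilton, so two passages through the block send `U` to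
`-U` and leave the quadratic current unchanged. Yet the current has changed by `Im z` times a
positive sum. -/
theorem im_eq_zero_of_trace_transferProd_eq_zero {a : ℕ → ℝ} {z : ℂ} (ha : ∀ n, a n ≠ 0) {n : ℕ}
    (hn : 0 < n) (h : (transferProd a z n).trace = 0) : z.im = 0 := by
  obtain ⟨U, hU⟩ : ∃ U : Fin 2 → ℂ, U = ![1, 0] := ⟨_, rfl⟩
  obtain ⟨V, hV⟩ : ∃ V, V = (transferProd a z n).mulVec U := ⟨_, rfl⟩
  have h1 := current_transferProd (z := z) ha U n
  have h2 := current_transferProd (z := z) ha V n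
  have h3 : (transferProd a z n).mulVec V = -U := by
    rw [hV, Matrix.mulVec_mulVec, Matrix.sq_eq_of_det_eq_one (det_transferProd ha n), h, zero_smul,
      zero_sub, Matrix.neg_mulVec, Matrix.one_mulVec]
  rw [h3] at h2
  rw [← hV] at h1
  have h4 : current (-U) = current U := by simp [current]
  have h5 : 1 ≤ ∑ i ∈ Finset.range n, ‖(transferProd a z i).mulVec U 0‖ ^ 2 := by
    refine le_trans ?_ (Finset.single_le_sum (fun i _ => sq_nonneg _) (Finset.mem_range.2 hn))
    simp [transferProd, hU]
  have h6 : 0 ≤ ∑ i ∈ Finset.range n, ‖(transferProd a z i).mulVec V 0‖ ^ 2 :=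
    Finset.sum_nonneg fun i _ => sq_nonneg _
  have h7 : z.im * (∑ i ∈ Finset.range n, ‖(transferProd a z i).mulVec U 0‖ ^ 2
      + ∑ i ∈ Finset.range n, ‖(transferProd a z i).mulVec V 0‖ ^ 2) = 0 := by linarith
  rcases mul_eq_zero.1 h7 with h8 | h8
  · exact h8
  · linarith

/-- The hopping sequence of the Fibonacci Hamiltonian on the positive sites. -/
noncomputable def fibHopping (l1 l2 : ℝ) (n : ℕ) : ℝ :=
  sturmianHopping l1 l2 goldenRotation (n : ℤ)

section

variable {l1 l2 : ℝ}

theorem fibHopping_pos (hl1 : 0 < l1) (hl2 : 0 < l2) (n : ℕ) : 0 < fibHopping l1 l2 n := by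
  rcases sturmianHopping_mem (l1 := l1) (l2 := l2) (n : ℤ) with h | h <;> rw [fibHopping, h] <;>
    assumption

theorem fibHopping_le (hl : l2 ≤ l1) (n : ℕ) : fibHopping l1 l2 n ≤ l1 := by
  rcases sturmianHopping_mem (l1 := l1) (l2 := l2) (n : ℤ) with h | h <;> rw [fibHopping, h]
  assumption

/-- The matrix over the `k`-th Fibonacci block; for `k = 1` the block is the single letter `l2`. -/
noncomputable def blockMatrix (l1 l2 : ℝ) (z : ℂ) (k : ℕ) : Matrix (Fin 2) (Fin 2) ℂ :=
  if k = 1 then transferMatrix z l2 else transferProd (fibHopping l1 l2) z (Nat.fib k)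

theorem blockMatrix_of_two_le {k : ℕ} (hk : 2 ≤ k) (z : ℂ) :
    blockMatrix l1 l2 z k = transferProd (fibHopping l1 l2) z (Nat.fib k) := by
  rw [blockMatrix, if_neg (by omega)]

theorem transferProd_two (z : ℂ) : transferProd (fibHopping l1 l2) z 2
    = transferMatrix z l2 * transferMatrix z l1 := by
  have h1 : fibHopping l1 l2 1 = l1 := sturmianHopping_one
  have h2 : fibHopping l1 l2 2 = l2 := sturmianHopping_two
  simp only [transferProd, zero_add, Nat.reduceAdd, h1, h2, mul_one]

theorem blockMatrix_two (z : ℂ) : blockMatrix l1 l2 z 2 = transferMatrix z l1 := by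
  have h1 : fibHopping l1 l2 1 = l1 := sturmianHopping_one
  rw [blockMatrix_of_two_le le_rfl, Nat.fib_two]
  simp only [transferProd, zero_add, h1, mul_one]

/-- The first `F_{k+2}` sites consist of the first `F_{k+1}` sites followed by a copy of the first
`F_k`. For `k = 1` this is the word `l1 l2`, which is why the block of index 1 has to be the letter
`l2`. -/
theorem blockMatrix_add_two {k : ℕ} (hk : 1 ≤ k) (z : ℂ) :
    blockMatrix l1 l2 z (k + 2) = blockMatrix l1 l2 z k * blockMatrix l1 l2 z (k + 1) := by
  rcases hk.eq_or_lt with rfl | hk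
  · rw [blockMatrix_of_two_le (by omega)]
    exact (transferProd_two z).trans (by rw [blockMatrix_two]; rfl)
  · rw [blockMatrix_of_two_le (by omega), blockMatrix_of_two_le (by omega),
      blockMatrix_of_two_le (by omega), Nat.fib_add_two]
    refine transferProd_add fun i h1 h2 => ?_
    refine sturmianHopping_add_fib h1 ?_
    have := Nat.fib_mono (show 3 ≤ k + 1 by omega)
    have h3 : Nat.fib 3 = 2 := rfl
    rw [Nat.fib_add_two]
    omega

theorem det_blockMatrix (hl1 : 0 < l1) (hl2 : 0 < l2) (z : ℂ) (k : ℕ) :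
    (blockMatrix l1 l2 z k).det = 1 := by
  rw [blockMatrix]
  split_ifs
  · exact det_transferMatrix z hl2.ne'
  · exact det_transferProd (fun n => (fibHopping_pos hl1 hl2 n).ne') _

theorem aeval_tracePoly (hl1 : 0 < l1) (hl2 : 0 < l2) (z : ℂ) (k : ℕ) (hk : 1 ≤ k) :
    Polynomial.aeval z (tracePoly l1 l2 k) = (blockMatrix l1 l2 z k).trace := by
  have hl1' : (l1 : ℂ) ≠ 0 := by exact_mod_cast hl1.ne'
  have hl2' : (l2 : ℂ) ≠ 0 := by exact_mod_cast hl2.ne'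
  induction k using Nat.strong_induction_on with
  | _ k ih =>
  match k, ih, hk with
  | 1, _, _ =>
    have : blockMatrix l1 l2 z 1 = transferMatrix z l2 := rfl
    rw [this, transferMatrix, Matrix.trace_fin_two_of]
    simp [tracePoly]; ring
  | 2, _, _ =>
    rw [blockMatrix_two, transferMatrix, Matrix.trace_fin_two_of]
    simp [tracePoly]; ring
  | 3, _, _ =>
    rw [blockMatrix_add_two le_rfl, blockMatrix_two,
      show blockMatrix l1 l2 z 1 = transferMatrix z l2 from rfl, transferMatrix, transferMatrix,
      Matrix.mul_fin_two, Matrix.trace_fin_two_of]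
    simp [tracePoly]; field_simp; ring
  | k + 4, ih, _ =>
    rw [tracePoly, map_sub, map_mul, ih (k + 3) (by omega) (by omega),
      ih (k + 2) (by omega) (by omega), ih (k + 1) (by omega) (by omega),
      blockMatrix_add_two (k := k + 2) (by omega)]
    have h3 := blockMatrix_add_two (l1 := l1) (l2 := l2) (k := k + 1) (by omega) z
    rw [show k + 1 + 2 = k + 3 from rfl] at h3
    -- Cyclicity of the trace brings two copies of the middle block together; Cayley-Hamilton for
    -- their product then gives the trace map.
    have e : (blockMatrix l1 l2 z (k + 2) * blockMatrix l1 l2 z (k + 2 + 1)).trace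
        = (blockMatrix l1 l2 z (k + 1)
          * (blockMatrix l1 l2 z (k + 2) * blockMatrix l1 l2 z (k + 2))).trace := by
      rw [h3, Matrix.trace_mul_comm, Matrix.mul_assoc]
    rw [e, Matrix.sq_eq_of_det_eq_one (det_blockMatrix hl1 hl2 z (k + 2)), Matrix.mul_sub,
      Matrix.mul_one, Matrix.mul_smul, Matrix.trace_sub, Matrix.trace_smul, ← h3, smul_eq_mul]
    ring

end

/-! ### Large traces off the real axis and decay on half-lines -/

section

variable {l1 l2 c δ w : ℝ}

theorem norm_aeval_tracePoly_gt (hl1 : 0 < l1) (hl2 : 0 < l2)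
    (hl : l2 ≤ l1) (hc : c = (l1 ^ 2 - l2 ^ 2) / (l1 * l2)) (hc8 : 8 < c) (hδ : 0 < δ)
    (hδc : δ * (100 * c) ≤ 1) (hw1 : 1 ≤ w) (hw2 : w ^ 2 ≤ 2 * c - 4) (hwc : c - 1 ≤ w ^ 2)
    (hw3 : w ^ 3 ≤ (c - 1) ^ 2) {k : ℕ} (hk : 2 ≤ k) {z : ℂ}
    (hz : 2 + δ < 1 / (l1 * w ^ 5) * w ^ k * |z.im|) :
    2 + δ < ‖Polynomial.aeval z (tracePoly l1 l2 k)‖ := by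
  have hw0 : 0 < w := by linarith
  by_contra! hcon
  refine absurd hz (not_lt.2 ?_)
  refine Polynomial.mul_abs_im_le_of_norm_aeval_le (p := tracePoly l1 l2 k) ?_ (by positivity)
    (fun x hx => (tracePoly_traceOrbit l1 l2 x).deriv_lower_bound hl1 hl2 hl hc hc8 hδ hδc hw1 hw2
      hwc hw3 hk hx) hcon
  intro v hv
  rw [aeval_tracePoly hl1 hl2 v k (by omega), blockMatrix_of_two_le hk] at hv
  exact im_eq_zero_of_trace_transferProd_eq_zero (fun n => (fibHopping_pos hl1 hl2 n).ne')
    (Nat.fib_pos.2 (by omega)) hv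

theorem pow_fib_le_norm_trace (hl1 : 0 < l1) (hl2 : 0 < l2)
    (hl : l2 ≤ l1) (hc : c = (l1 ^ 2 - l2 ^ 2) / (l1 * l2)) (hc8 : 8 < c) (hδ : 0 < δ)
    (hδc : δ * (100 * c) ≤ 1) (hw1 : 1 ≤ w) (hw2 : w ^ 2 ≤ 2 * c - 4) (hwc : c - 1 ≤ w ^ 2)
    (hw3 : w ^ 3 ≤ (c - 1) ^ 2) {k n : ℕ} (hk : 2 ≤ k) {z : ℂ}
    (hz : 2 + δ < 1 / (l1 * w ^ 5) * w ^ k * |z.im|) :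
    (1 + δ) ^ Nat.fib n ≤ ‖(transferProd (fibHopping l1 l2) z (Nat.fib (k + n))).trace‖ := by
  have hw0 : 0 < w := by linarith
  obtain ⟨j, rfl⟩ := Nat.exists_eq_add_of_le' (show 1 ≤ k by omega)
  have hz' : 2 + δ < 1 / (l1 * w ^ 5) * w ^ (j + 2) * |z.im| := by
    refine hz.trans_le (mul_le_mul_of_nonneg_right ?_ (abs_nonneg _))
    exact mul_le_mul_of_nonneg_left (pow_le_pow_right₀ hw1 (by omega)) (by positivity)
  have g1 := norm_aeval_tracePoly_gt hl1 hl2 hl hc hc8 hδ hδc hw1 hw2 hwc hw3 hk hz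
  have g2 := norm_aeval_tracePoly_gt hl1 hl2 hl hc hc8 hδ hδc hw1 hw2 hwc hw3
    (k := j + 2) (by omega) hz'
  have g := (traceMap_escape_of_pair (x := fun k => Polynomial.aeval z (tracePoly l1 l2 k))
    (fun k => by simp [tracePoly]) hδ ?_ g1 g2 n).2
  · rw [← blockMatrix_of_two_le (by omega), ← aeval_tracePoly hl1 hl2 z _ (by omega)]
    exact g.trans (by linarith)
  · intro _ h2
    apply le_max_of_le_left
    have e0 : Polynomial.aeval z (tracePoly l1 l2 0) = ((l1 / l2 + l2 / l1 : ℝ) : ℂ) := by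
      simp [tracePoly]
    have e1 : Polynomial.aeval z (tracePoly l1 l2 1)
        = ((l1 / l2 : ℝ) : ℂ) * Polynomial.aeval z (tracePoly l1 l2 2) := by
      have hl1' : (l1 : ℂ) ≠ 0 := by exact_mod_cast hl1.ne'
      have hl2' : (l2 : ℂ) ≠ 0 := by exact_mod_cast hl2.ne'
      simp [tracePoly]; field_simp
    have r1 : 1 ≤ l1 / l2 := (one_le_div hl2).2 hl
    have r2 : l2 / l1 ≤ 1 := (div_le_one hl1).2 hl
    rw [e0, e1, norm_mul, Complex.norm_real, Complex.norm_real, Real.norm_eq_abs, Real.norm_eq_abs,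
      abs_of_pos (by positivity : 0 < l1 / l2), abs_of_pos (by positivity)]
    nlinarith

/-- A bounded solution of the half-line eigenvalue equation that vanishes at infinity is small
beyond a repeated block with large trace. -/
theorem halfLine_decay (hl1 : 0 < l1) (hl2 : 0 < l2) (hl : l2 ≤ l1) {z : ℂ} (hz : 0 < z.im)
    {v : ℕ → ℂ} {B : ℝ} (hB : ∀ m, ‖v m‖ ≤ B) (hv : Tendsto v atTop (nhds 0))
    (heq : ∀ m : ℕ, (fibHopping l1 l2 (m + 2) : ℂ) * v (m + 3)
      + (fibHopping l1 l2 (m + 1) : ℂ) * v (m + 1) = z * v (m + 2))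
    {k : ℕ} (hk : 4 ≤ k) {Q : ℝ} (hQ : 0 < Q)
    (hQx : Q ≤ ‖(transferProd (fibHopping l1 l2) z (Nat.fib k)).trace‖) {m : ℕ}
    (hm : Nat.fib k + 1 ≤ m) :
    z.im * ‖v m‖ ^ 2 ≤ (2 * ((‖z‖ + l1 + 1) * B) / Q) ^ 2 := by
  obtain ⟨a, ha⟩ : ∃ a, a = fibHopping l1 l2 := ⟨_, rfl⟩
  rw [← ha] at heq hQx
  have ha0 : ∀ n, a n ≠ 0 := fun n => ha ▸ (fibHopping_pos hl1 hl2 n).ne'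
  have hal : ∀ n, ‖(a n : ℂ)‖ ≤ l1 := fun n => by
    rw [Complex.norm_real, Real.norm_eq_abs, ha, abs_of_pos (fibHopping_pos hl1 hl2 n)]
    exact fibHopping_le hl n
  have hB0 : 0 ≤ B := (norm_nonneg _).trans (hB 0)
  -- For `n ≥ 1` the second coordinate equals `a(n) v(n)`. Written through the sites to the right,
  -- it also makes sense at `n = 0` without the equation at site 1, where the resolvent has its
  -- source.
  obtain ⟨U, hU⟩ : ∃ U : ℕ → Fin 2 → ℂ,
    U = fun n => ![v (n + 1), z * v (n + 1) - a (n + 1) * v (n + 2)] := ⟨_, rfl⟩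
  have hU0 : ∀ n, U n 0 = v (n + 1) := fun n => by rw [hU]; rfl
  have hU1 : ∀ n, U n 1 = z * v (n + 1) - a (n + 1) * v (n + 2) := fun n => by rw [hU]; rfl
  have hU1' : ∀ n, U (n + 1) 1 = a (n + 1) * v (n + 1) := fun n => by
    rw [hU1]; linear_combination -heq n
  have hstep : ∀ n, U (n + 1) = (transferMatrix z (a (n + 1))).mulVec (U n) := by
    intro n
    have ha' : (a (n + 1) : ℂ) ≠ 0 := by exact_mod_cast ha0 _
    ext i
    fin_cases i
    · simp only [transferMatrix, Matrix.mulVec, dotProduct, Fin.sum_univ_two, Matrix.of_apply,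
        Matrix.cons_val_zero, Matrix.cons_val_one, Fin.zero_eta, hU0, hU1]
      field_simp; ring
    · simp only [transferMatrix, Matrix.mulVec, dotProduct, Fin.sum_univ_two, Matrix.of_apply,
        Matrix.cons_val_zero, Matrix.cons_val_one, Fin.mk_one, hU0, hU1']
      ring
  have hprod : ∀ n, U n = (transferProd a z n).mulVec (U 0) := by
    intro n
    induction n with
    | zero => simp [transferProd]
    | succ n ih => rw [hstep, ih, transferProd, Matrix.mulVec_mulVec]
  have hbound : ∀ n i, ‖U n i‖ ≤ (‖z‖ + l1 + 1) * B := by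
    intro n i
    fin_cases i
    · simp only [Fin.zero_eta, hU0]
      refine (hB _).trans ?_
      nlinarith [norm_nonneg z]
    · simp only [Fin.mk_one, hU1]
      refine (norm_sub_le _ _).trans ?_
      rw [norm_mul, norm_mul]
      have e1 := mul_le_mul_of_nonneg_left (hB (n + 1)) (norm_nonneg z)
      have e2 := mul_le_mul (hal (n + 1)) (hB (n + 2)) (norm_nonneg _) hl1.le
      linarith
  obtain ⟨F, hF⟩ : ∃ F, F = Nat.fib k := ⟨_, rfl⟩
  rw [← hF] at hQx hm
  have hper : transferProd a z (F + F) = transferProd a z F * transferProd a z F := by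
    refine transferProd_add fun i h1 h2 => ?_
    obtain ⟨j, rfl⟩ := Nat.exists_eq_add_of_le' (show 1 ≤ k by omega)
    rw [ha, hF]
    refine sturmianHopping_add_fib h1 ?_
    have := Nat.fib_mono (show 3 ≤ j by omega)
    have h3 : Nat.fib 3 = 2 := rfl
    rw [Nat.fib_add_two]
    omega
  -- Gordon's two-block argument: the block repeats, so `M_{2F} = M_F² = (tr M_F) M_F - 1`. As the
  -- states at `0` and `2F` are bounded, a large trace forces the state at `F` to be small.
  have hgordon : ∀ i, (transferProd a z F).trace * U F i = U (F + F) i + U 0 i := by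
    intro i
    have : U (F + F) = (transferProd a z F).trace • U F - U 0 := by
      rw [hprod (F + F), hper, Matrix.sq_eq_of_det_eq_one (det_transferProd ha0 F),
        Matrix.sub_mulVec, Matrix.smul_mulVec, Matrix.one_mulVec, ← hprod F]
    rw [this]; simp
  have hUF : ∀ i, ‖U F i‖ ≤ 2 * ((‖z‖ + l1 + 1) * B) / Q := by
    intro i
    rw [le_div_iff₀ hQ]
    have h1 := congrArg norm (hgordon i)
    rw [norm_mul] at h1
    have h2 := mul_le_mul_of_nonneg_right hQx (norm_nonneg (U F i))
    have h3 := norm_add_le (U (F + F) i) (U 0 i)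
    have := hbound (F + F) i
    have := hbound 0 i
    linarith
  have hcur : ∀ n, current (U (n + 1)) = current (U n) + z.im * ‖v (n + 1)‖ ^ 2 := by
    intro n
    rw [hstep, current_transferMatrix z (ha0 _), hU0]
  have hmono : Monotone fun n => current (U n) := by
    refine monotone_nat_of_le_succ fun n => ?_
    rw [hcur]
    have := mul_nonneg hz.le (sq_nonneg ‖v (n + 1)‖)
    linarith
  have hcabs : ∀ n, |current (U n)| ≤ ‖U n 0‖ * ‖U n 1‖ := by
    intro n
    refine (Complex.abs_im_le_norm _).trans ?_
    rw [norm_mul, RCLike.norm_conj]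
  have hlim : Tendsto (fun n => current (U (n + 1))) atTop (nhds 0) := by
    have h1 : Tendsto (fun n => ‖v (n + 2)‖ * (l1 * B)) atTop (nhds 0) := by
      have := ((tendsto_add_atTop_iff_nat 2).2 hv).norm.mul_const (l1 * B)
      simpa using this
    refine squeeze_zero_norm (fun n => ?_) h1
    rw [Real.norm_eq_abs]
    refine (hcabs _).trans ?_
    rw [hU0, hU1', norm_mul]
    refine mul_le_mul_of_nonneg_left ?_ (norm_nonneg _)
    exact mul_le_mul (hal _) (hB _) (norm_nonneg _) hl1.le
  -- The current increases to 0, so it is never positive. Each increment `Im z ‖v m‖²` beyond `F` is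
  -- then at most `|current (U F)|`.
  have hneg : ∀ n, current (U n) ≤ 0 := by
    intro n
    refine ge_of_tendsto hlim ?_
    filter_upwards [eventually_ge_atTop n] with i hi
    exact hmono (hi.trans (Nat.le_succ i))
  obtain ⟨n, rfl⟩ := Nat.exists_eq_add_of_le' (show 1 ≤ m by omega)
  have h1 := hneg (n + 1)
  rw [hcur] at h1
  have h2 : current (U F) ≤ current (U n) := hmono (by omega)
  have h3 := (neg_le_abs _).trans (hcabs F)
  have h4 : ‖U F 0‖ * ‖U F 1‖ ≤ (2 * ((‖z‖ + l1 + 1) * B) / Q) ^ 2 := by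
    rw [sq]
    exact mul_le_mul (hUF 0) (hUF 1) (norm_nonneg _) ((norm_nonneg _).trans (hUF 0))
  linarith

end

/-! ### Self-adjointness, time evolution and its Laplace transform -/

theorem weightedShift_isSymmetricPair (a : ℤ → ℝ) (ha : ∃ C : ℝ, ∀ n, |a n| ≤ C) (b : ℤ → ℝ)
    (hb : ∃ C : ℝ, ∀ n, |b n| ≤ C) (e : ℤ ≃ ℤ) (hab : ∀ n, b (e n) = a n) (x y : EllTwo) :
    inner ℂ (weightedShift a ha e x) y = inner ℂ x (weightedShift b hb e.symm y) := by
  rw [lp.inner_eq_tsum, lp.inner_eq_tsum, ← e.tsum_eq fun i => inner ℂ (x i) _]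
  refine tsum_congr fun n => ?_
  have h1 : weightedShift a ha e x n = (a n : ℂ) * x (e n) := rfl
  have h2 : weightedShift b hb e.symm y (e n) = (b (e n) : ℂ) * y (e.symm (e n)) := rfl
  rw [h1, h2, hab, e.symm_apply_apply, RCLike.inner_apply, RCLike.inner_apply, map_mul,
    Complex.conj_ofReal]
  ring

theorem jacobiOperator_isSelfAdjoint (a b : ℤ → ℝ) (ha : ∃ C : ℝ, ∀ n, |a n| ≤ C)
    (hb : ∃ C : ℝ, ∀ n, |b n| ≤ C) : IsSelfAdjoint (jacobiOperator a b ha hb) := by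
  rw [ContinuousLinearMap.isSelfAdjoint_iff_isSymmetric]
  intro x y
  simp only [ContinuousLinearMap.coe_coe, jacobiOperator, _root_.add_apply,
    inner_add_left, inner_add_right]
  have ha' : ∃ C : ℝ, ∀ n : ℤ, |a (n - 1)| ≤ C := ha.imp fun _ h n => h (n - 1)
  have h1 := weightedShift_isSymmetricPair a ha (fun n => a (n - 1)) ha' (Equiv.addRight 1)
    (fun n => by simp) x y
  have h2 := weightedShift_isSymmetricPair (fun n => a (n - 1)) ha' a ha (Equiv.subRight 1)
    (fun n => by simp) x y
  have h3 := weightedShift_isSymmetricPair b hb b hb (Equiv.refl ℤ) (fun n => rfl) x y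
  have e1 : (Equiv.addRight (1 : ℤ)).symm = Equiv.subRight 1 := by ext; simp [sub_eq_add_neg]
  have e2 : (Equiv.subRight (1 : ℤ)).symm = Equiv.addRight 1 := by ext; simp
  rw [e1] at h1
  rw [e2] at h2
  rw [h1, h2, h3, Equiv.refl_symm]
  ring

section Evolution

variable (H : EllTwo →L[ℂ] EllTwo)

/-- The state `e^{-itH} δ₁`. -/
noncomputable def evolution (t : ℝ) : EllTwo :=
  NormedSpace.exp ((-(Complex.I * (t : ℂ))) • H) (siteVector 1)

theorem siteProb_eq (n : ℤ) (t : ℝ) : siteProb H n t = ‖evolution H t n‖ ^ 2 := by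
  rw [siteProb, evolution, siteVector, siteVector, lp.inner_single_right]
  simp

theorem evolution_zero : evolution H 0 = siteVector 1 := by
  simp [evolution]

theorem hasDerivAt_evolution (t : ℝ) :
    HasDerivAt (evolution H) ((-Complex.I) • H (evolution H t)) t := by
  have h1 := hasDerivAt_exp_smul_const' (𝕂 := ℂ) ((-Complex.I) • H) (t : ℂ)
  have h2 := h1.scomp t Complex.ofRealCLM.hasDerivAt
  have h3 := ((ContinuousLinearMap.apply ℂ EllTwo (siteVector 1)).restrictScalars
    ℝ).hasFDerivAt.comp_hasDerivAt t h2
  have e : ∀ s : ℝ, ((s : ℂ) • (-Complex.I) • H) = (-(Complex.I * (s : ℂ))) • H := fun s => by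
    rw [smul_smul]; congr 1; ring
  refine (h3.congr_of_eventuallyEq (.of_forall fun s => ?_)).congr_deriv ?_
  · change NormedSpace.exp ((-(Complex.I * (s : ℂ))) • H) (siteVector 1) = _
    rw [← e]; rfl
  · change (((1 : ℝ) : ℂ) • ((-Complex.I) • H * NormedSpace.exp ((t : ℂ) • (-Complex.I) • H)))
      (siteVector 1) = _
    rw [Complex.ofReal_one, one_smul, e]; rfl

variable {H}

theorem norm_evolution (hH : IsSelfAdjoint H) (t : ℝ) : ‖evolution H t‖ = 1 := by
  have h1 : IsSelfAdjoint (((-t : ℝ) : ℂ) • H) := by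
    rw [IsSelfAdjoint, star_smul, hH.star_eq]
    congr 1
    exact Complex.conj_ofReal _
  have h2 : NormedSpace.exp ((-(Complex.I * (t : ℂ))) • H)
      = (selfAdjoint.expUnitary ⟨((-t : ℝ) : ℂ) • H, selfAdjoint.mem_iff.2 h1⟩ :
        EllTwo →L[ℂ] EllTwo) := by
    rw [selfAdjoint.expUnitary_coe, smul_smul]
    congr 2
    push_cast
    ring
  rw [evolution, h2, Unitary.norm_map, siteVector, lp.norm_single (by norm_num)]
  simp

theorem norm_evolution_apply_le (hH : IsSelfAdjoint H) (t : ℝ) (n : ℤ) :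
    ‖evolution H t n‖ ≤ 1 :=
  (lp.norm_apply_le_norm (by norm_num) _ n).trans (norm_evolution hH t).le

theorem continuous_evolution : Continuous (evolution H) :=
  continuous_iff_continuousAt.2 fun t => (hasDerivAt_evolution H t).continuousAt

/-- The Laplace transform `∫_0^∞ e^{izt} e^{-itH} δ₁ dt`, which is `i (z - H)⁻¹ δ₁`. -/
noncomputable def evolutionLaplace (H : EllTwo →L[ℂ] EllTwo) (z : ℂ) : EllTwo :=
  ∫ t in Set.Ioi (0 : ℝ), Complex.exp (Complex.I * z * t) • evolution H t

theorem norm_exp_I_mul (z : ℂ) (t : ℝ) :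
    ‖Complex.exp (Complex.I * z * t)‖ = Real.exp (-z.im * t) := by
  rw [Complex.norm_exp]; simp

theorem norm_laplace_integrand (hH : IsSelfAdjoint H) (z : ℂ) (t : ℝ) :
    ‖Complex.exp (Complex.I * z * t) • evolution H t‖ = Real.exp (-z.im * t) := by
  rw [norm_smul, norm_evolution hH, mul_one, norm_exp_I_mul]

theorem continuous_laplace_integrand (z : ℂ) :
    Continuous fun t : ℝ => Complex.exp (Complex.I * z * t) • evolution H t :=
  (by fun_prop : Continuous fun t : ℝ => Complex.exp (Complex.I * z * t)).smul continuous_evolution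

theorem integrable_laplace_integrand (hH : IsSelfAdjoint H) {z : ℂ} (hz : 0 < z.im) :
    IntegrableOn (fun t : ℝ => Complex.exp (Complex.I * z * t) • evolution H t) (Set.Ioi 0) := by
  refine Integrable.mono' (exp_neg_integrableOn_Ioi 0 hz)
    (continuous_laplace_integrand z).aestronglyMeasurable ?_
  exact Eventually.of_forall fun t => (norm_laplace_integrand hH z t).le

theorem norm_evolutionLaplace_le (hH : IsSelfAdjoint H) {z : ℂ} (hz : 0 < z.im) :
    ‖evolutionLaplace H z‖ ≤ 1 / z.im := by
  refine (norm_integral_le_integral_norm _).trans ?_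
  simp_rw [norm_laplace_integrand hH]
  rw [integral_exp_mul_Ioi (by linarith)]
  simp [div_eq_mul_inv]

theorem norm_evolutionLaplace_apply_le (hH : IsSelfAdjoint H) {z : ℂ} (hz : 0 < z.im) (n : ℤ) :
    ‖evolutionLaplace H z n‖ ≤ 1 / z.im :=
  (lp.norm_apply_le_norm (by norm_num) _ n).trans (norm_evolutionLaplace_le hH hz)

theorem evolutionLaplace_apply (hH : IsSelfAdjoint H) {z : ℂ} (hz : 0 < z.im) (n : ℤ) :
    evolutionLaplace H z n
      = ∫ t in Set.Ioi (0 : ℝ), Complex.exp (Complex.I * z * t) * evolution H t n := by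
  have := (lp.evalCLM ℂ (fun _ : ℤ => ℂ) 2 n).integral_comp_comm
    (integrable_laplace_integrand hH hz)
  exact this.symm

/-- Integrating the derivative of `e^{izt} e^{-itH} δ₁` over `(0, ∞)` leaves only the boundary value
at 0, the source `δ₁`. -/
theorem map_evolutionLaplace (hH : IsSelfAdjoint H) {z : ℂ} (hz : 0 < z.im) :
    H (evolutionLaplace H z) = z • evolutionLaplace H z - Complex.I • siteVector 1 := by
  have hint := integrable_laplace_integrand hH hz
  have hintH : IntegrableOn (fun t : ℝ => Complex.exp (Complex.I * z * t) • H (evolution H t))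
      (Set.Ioi 0) := by
    have := H.integrable_comp hint
    simpa [IntegrableOn] using this
  have hderiv : ∀ t : ℝ, HasDerivAt
      (fun t : ℝ => Complex.exp (Complex.I * z * t) • evolution H t)
      ((Complex.I * z) • (Complex.exp (Complex.I * z * t) • evolution H t)
        + (-Complex.I) • (Complex.exp (Complex.I * z * t) • H (evolution H t))) t := by
    intro t
    have h1 : HasDerivAt (fun t : ℝ => Complex.exp (Complex.I * z * t))
        (Complex.exp (Complex.I * z * t) * (Complex.I * z)) t := by
      have := ((hasDerivAt_id (t : ℂ)).const_mul (Complex.I * z)).cexp.comp_ofReal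
      simpa using this
    have h2 := h1.smul (hasDerivAt_evolution H t)
    refine h2.congr_deriv ?_
    rw [smul_smul, smul_smul, smul_smul, add_comm,
      mul_comm (Complex.I * z) (Complex.exp _), mul_comm (-Complex.I)]
  have hlim : Tendsto (fun t : ℝ => Complex.exp (Complex.I * z * t) • evolution H t) atTop
      (nhds 0) := by
    rw [tendsto_zero_iff_norm_tendsto_zero]
    simp_rw [norm_laplace_integrand hH]
    refine Real.tendsto_exp_atBot.comp ?_
    exact tendsto_id.const_mul_atTop_of_neg (by linarith)
  have h0 := integral_Ioi_of_hasDerivAt_of_tendsto' (fun t _ => hderiv t)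
    ((hint.smul (Complex.I * z)).add (hintH.smul (-Complex.I))) hlim
  have h1 : (Complex.I * z) • evolutionLaplace H z + (-Complex.I) • H (evolutionLaplace H z)
      = -siteVector 1 := by
    have i1 : IntegrableOn (fun t : ℝ => (Complex.I * z) •
      (Complex.exp (Complex.I * z * t) • evolution H t)) (Set.Ioi 0) :=
      Integrable.smul (Complex.I * z) hint
    have i2 : IntegrableOn (fun t : ℝ => (-Complex.I) •
      (Complex.exp (Complex.I * z * t) • H (evolution H t))) (Set.Ioi 0) :=
      Integrable.smul (-Complex.I) hintH
    rw [evolutionLaplace, ← H.integral_comp_comm hint, ← integral_smul, ← integral_smul]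
    simp only [map_smul]
    rw [← integral_add i1 i2, h0, evolution_zero]; simp
  have h2 := congrArg (fun v => Complex.I • v) h1
  simp only [smul_add, smul_smul, smul_neg] at h2
  rw [← mul_assoc, Complex.I_mul_I, mul_neg, Complex.I_mul_I] at h2
  rw [neg_neg, one_smul, neg_mul, one_mul, neg_smul] at h2
  rw [← sub_eq_zero] at h2 ⊢
  rw [← h2]; abel

open FourierTransform in
/-- Inverting the Laplace transform along a horizontal line. -/
theorem exp_mul_norm_evolution_le (hH : IsSelfAdjoint H) {η κ : ℝ} (hη : 0 < η) {n : ℤ}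
    (hκ : ∀ x : ℝ, ‖evolutionLaplace H (x + η * Complex.I) n‖ ≤ κ / (1 + x ^ 2)) {t : ℝ}
    (ht : 0 < t) : Real.exp (-η * t) * ‖evolution H t n‖ ≤ κ * Real.pi := by
  have hκ0 : 0 ≤ κ := by
    have := (norm_nonneg _).trans (hκ 0)
    simpa using this
  have hcont : Continuous fun t : ℝ => evolution H t n :=
    (lp.evalCLM ℂ (fun _ : ℤ => ℂ) 2 n).continuous.comp continuous_evolution
  obtain ⟨g, hg⟩ : ∃ g : ℝ → ℂ, g = fun t : ℝ => (Real.exp (-η * t) : ℂ) * evolution H t n :=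
    ⟨_, rfl⟩
  have hgc : Continuous g := by
    rw [hg]; exact (by fun_prop : Continuous fun t : ℝ => (Real.exp (-η * t) : ℂ)).mul hcont
  obtain ⟨f, hf⟩ : ∃ f : ℝ → ℂ, f = (Set.Ioi (0 : ℝ)).indicator g := ⟨_, rfl⟩
  have hgi : IntegrableOn g (Set.Ioi 0) := by
    refine Integrable.mono' (exp_neg_integrableOn_Ioi 0 hη) hgc.aestronglyMeasurable ?_
    refine Eventually.of_forall fun t => ?_
    rw [hg, norm_mul, Complex.norm_real, Real.norm_eq_abs, Real.abs_exp]
    exact mul_le_of_le_one_right (Real.exp_pos _).le (norm_evolution_apply_le hH t n)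
  have hfi : Integrable f := by rw [hf, integrable_indicator_iff measurableSet_Ioi]; exact hgi
  have hF : ∀ ξ : ℝ, 𝓕 f ξ = evolutionLaplace H ((-2 * Real.pi * ξ : ℝ) + η * Complex.I) n := by
    intro ξ
    rw [Real.fourier_real_eq_integral_exp_smul, evolutionLaplace_apply hH (by simpa using hη), hf]
    have hind : (fun v : ℝ => Complex.exp (↑(-2 * Real.pi * v * ξ) * Complex.I) •
        (Set.Ioi (0 : ℝ)).indicator g v) = (Set.Ioi (0 : ℝ)).indicator fun v : ℝ =>
          Complex.exp (↑(-2 * Real.pi * v * ξ) * Complex.I) • g v := by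
      ext v
      by_cases hv : v ∈ Set.Ioi (0 : ℝ)
      · rw [Set.indicator_of_mem hv, Set.indicator_of_mem hv]
      · rw [Set.indicator_of_notMem hv, Set.indicator_of_notMem hv, smul_zero]
    rw [hind, integral_indicator measurableSet_Ioi]
    refine integral_congr_ae (Eventually.of_forall fun s => ?_)
    simp only [hg, smul_eq_mul]
    rw [← mul_assoc, Complex.ofReal_exp, ← Complex.exp_add]
    congr 2
    push_cast
    linear_combination (-(s : ℂ) * η) * Complex.I_sq
  -- The frequency `ξ` corresponds to `Re z = -2πξ`, and `(2πξ)² ≥ ξ²`; the majorant kept here has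
  -- integral `κπ`.
  have hbound : ∀ ξ : ℝ, ‖𝓕 f ξ‖ ≤ κ * (1 + ξ ^ 2)⁻¹ := by
    intro ξ
    rw [hF]
    refine (hκ _).trans ?_
    rw [div_eq_mul_inv]
    refine mul_le_mul_of_nonneg_left ?_ hκ0
    refine inv_anti₀ (by positivity) ?_
    have : 1 ≤ (2 * Real.pi) ^ 2 := by nlinarith [Real.pi_gt_three]
    nlinarith [sq_nonneg ξ]
  have hFc : Continuous (𝓕 f) :=
    VectorFourier.fourierIntegral_continuous Real.continuous_fourierChar
      (by exact continuous_inner) hfi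
  have hmaj : Integrable fun ξ : ℝ => κ * (1 + ξ ^ 2)⁻¹ := integrable_inv_one_add_sq.const_mul κ
  have hFi : Integrable (𝓕 f) :=
    hmaj.mono' hFc.aestronglyMeasurable (Eventually.of_forall hbound)
  have hft : f =ᶠ[nhds t] g := by
    filter_upwards [Ioi_mem_nhds ht] with s hs
    rw [hf, Set.indicator_of_mem hs]
  have hinv := hfi.fourierInv_fourier_eq hFi (hgc.continuousAt.congr hft.symm)
  have hgt : ‖g t‖ = Real.exp (-η * t) * ‖evolution H t n‖ := by
    rw [hg, norm_mul, Complex.norm_real, Real.norm_eq_abs, Real.abs_exp]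
  rw [← hgt, ← hft.self_of_nhds, ← hinv, Real.fourierInv_eq]
  refine (norm_integral_le_integral_norm _).trans ?_
  rw [← integral_univ_inv_one_add_sq, ← integral_const_mul]
  refine integral_mono_of_nonneg (Eventually.of_forall fun ξ => norm_nonneg _) hmaj
    (Eventually.of_forall fun ξ => ?_)
  simp only [Circle.norm_smul]
  exact hbound ξ

end Evolution

/-! ### Decay of the resolvent and of the evolution -/

section Decay

variable {l1 l2 c δ w : ℝ}

theorem fibonacciHamiltonian_isSelfAdjoint (l1 l2 : ℝ) :
    IsSelfAdjoint (fibonacciHamiltonian l1 l2) :=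
  jacobiOperator_isSelfAdjoint _ _ _ _

theorem evolutionLaplace_eigenvalue_eq (l1 l2 : ℝ) {z : ℂ} (hz : 0 < z.im) {n : ℤ} (hn : n ≠ 1) :
    (sturmianHopping l1 l2 goldenRotation n : ℂ)
        * evolutionLaplace (fibonacciHamiltonian l1 l2) z (n + 1)
      + (sturmianHopping l1 l2 goldenRotation (n - 1) : ℂ)
        * evolutionLaplace (fibonacciHamiltonian l1 l2) z (n - 1)
      = z * evolutionLaplace (fibonacciHamiltonian l1 l2) z n := by
  have h := map_evolutionLaplace (fibonacciHamiltonian_isSelfAdjoint l1 l2) hz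
  have h1 := congrArg (fun v : EllTwo => v n) h
  simp only at h1
  rw [fibonacciHamiltonian, jacobiOperator_apply] at h1
  have h2 : (siteVector 1 : EllTwo) n = 0 := by
    rw [siteVector, lp.single_apply_ne _ _ _ hn]
  have h3 : ∀ G : EllTwo, (z • G - Complex.I • siteVector 1 : EllTwo) n = z * G n := by
    intro G
    have : (z • G - Complex.I • siteVector 1 : EllTwo) n
      = z * G n - Complex.I * (siteVector 1 : EllTwo) n := rfl
    rw [this, h2]; ring
  rw [h3] at h1
  rw [Complex.ofReal_zero, zero_mul, add_zero] at h1
  exact h1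

theorem norm_sturmianHopping_le (hl1 : 0 < l1) (hl2 : 0 < l2) (hl : l2 ≤ l1) (n : ℤ) :
    ‖(sturmianHopping l1 l2 goldenRotation n : ℂ)‖ ≤ l1 := by
  rw [Complex.norm_real, Real.norm_eq_abs]
  rcases sturmianHopping_mem (l1 := l1) (l2 := l2) n with h | h <;> rw [h]
  · rw [abs_of_pos hl1]
  · rwa [abs_of_pos hl2]

/-- Away from the source, `z G(n)` is a combination of the two neighbouring values with weights at
most `l1`, so each unit of distance from site 1 gains a factor `2 l1 / |z|`. -/
theorem norm_evolutionLaplace_mul_pow_le (hl1 : 0 < l1) (hl2 : 0 < l2) (hl : l2 ≤ l1) {z : ℂ}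
    (hz : 0 < z.im) (j : ℕ) (n : ℤ) (hn : (j : ℤ) ≤ |n - 1|) :
    ‖evolutionLaplace (fibonacciHamiltonian l1 l2) z n‖ * ‖z‖ ^ j ≤ (2 * l1) ^ j / z.im := by
  induction j generalizing n with
  | zero =>
    simpa using norm_evolutionLaplace_apply_le (fibonacciHamiltonian_isSelfAdjoint l1 l2) hz n
  | succ j ih =>
    have hn1 : n ≠ 1 := by
      rintro rfl
      simp at hn
      omega
    have h := congrArg norm (evolutionLaplace_eigenvalue_eq l1 l2 hz hn1)
    obtain ⟨G, hG⟩ : ∃ G, G = evolutionLaplace (fibonacciHamiltonian l1 l2) z := ⟨_, rfl⟩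
    rw [← hG] at h ih ⊢
    have h1 := ih (n + 1) (by push_cast at hn; grind)
    have h2 := ih (n - 1) (by push_cast at hn; grind)
    have h3 : ‖z‖ * ‖G n‖ ≤ l1 * ‖G (n + 1)‖ + l1 * ‖G (n - 1)‖ := by
      rw [← norm_mul, ← h]
      refine (norm_add_le _ _).trans ?_
      rw [norm_mul, norm_mul]
      exact add_le_add
        (mul_le_mul_of_nonneg_right (norm_sturmianHopping_le hl1 hl2 hl n) (norm_nonneg _))
        (mul_le_mul_of_nonneg_right (norm_sturmianHopping_le hl1 hl2 hl _) (norm_nonneg _))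
    have h4 := mul_le_mul_of_nonneg_right h3 (pow_nonneg (norm_nonneg z) j)
    calc ‖G n‖ * ‖z‖ ^ (j + 1) = ‖z‖ * ‖G n‖ * ‖z‖ ^ j := by ring
      _ ≤ (l1 * ‖G (n + 1)‖ + l1 * ‖G (n - 1)‖) * ‖z‖ ^ j := h4
      _ = l1 * (‖G (n + 1)‖ * ‖z‖ ^ j) + l1 * (‖G (n - 1)‖ * ‖z‖ ^ j) := by ring
      _ ≤ l1 * ((2 * l1) ^ j / z.im) + l1 * ((2 * l1) ^ j / z.im) :=
          add_le_add (mul_le_mul_of_nonneg_left h1 hl1.le) (mul_le_mul_of_nonneg_left h2 hl1.le)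
      _ = (2 * l1) ^ (j + 1) / z.im := by ring

theorem tendsto_lp_apply (G : EllTwo) {e : ℕ → ℤ} (he : Function.Injective e) :
    Tendsto (fun m => G (e m)) atTop (nhds 0) := by
  have h1 := (lp.memℓp G).summable (by norm_num : 0 < (2 : ENNReal).toReal)
  have h2 := h1.tendsto_cofinite_zero.comp he.tendsto_cofinite
  rw [Nat.cofinite_eq_atTop] at h2
  rw [tendsto_zero_iff_norm_tendsto_zero]
  have h3 := h2.sqrt
  rw [Real.sqrt_zero] at h3
  refine h3.congr fun m => ?_
  simp [Real.sqrt_sq]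

/-- Decay of the Laplace transform beyond a repeated Fibonacci block with large trace. -/
theorem norm_evolutionLaplace_sq_le (hl1 : 0 < l1) (hl2 : 0 < l2) (hl : l2 ≤ l1) {z : ℂ}
    (hz : 0 < z.im) {k : ℕ} (hk : 4 ≤ k) {Q : ℝ} (hQ : 0 < Q)
    (hQx : Q ≤ ‖(transferProd (fibHopping l1 l2) z (Nat.fib k)).trace‖) {n : ℤ}
    (hn : (Nat.fib k : ℤ) + 1 ≤ |n|) :
    z.im * ‖evolutionLaplace (fibonacciHamiltonian l1 l2) z n‖ ^ 2
      ≤ (2 * ((‖z‖ + l1 + 1) * (1 / z.im)) / Q) ^ 2 := by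
  obtain ⟨G, hG⟩ : ∃ G, G = evolutionLaplace (fibonacciHamiltonian l1 l2) z := ⟨_, rfl⟩
  have heq := fun {n : ℤ} (hn : n ≠ 1) => evolutionLaplace_eigenvalue_eq l1 l2 hz hn
  have hB := norm_evolutionLaplace_apply_le (fibonacciHamiltonian_isSelfAdjoint l1 l2) hz
  rw [← hG] at heq hB ⊢
  rcases le_total 0 n with h | h
  · rw [abs_of_nonneg h] at hn
    obtain ⟨m, rfl⟩ := Int.eq_ofNat_of_zero_le h
    refine halfLine_decay hl1 hl2 hl hz (v := fun m : ℕ => G (m : ℤ)) (fun m => hB _)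
      (tendsto_lp_apply G Nat.cast_injective) (fun m => ?_) hk hQ hQx (by omega)
    have := heq (n := ((m + 2 : ℕ) : ℤ)) (by omega)
    rw [show ((m + 2 : ℕ) : ℤ) + 1 = ((m + 3 : ℕ) : ℤ) by push_cast; ring,
      show ((m + 2 : ℕ) : ℤ) - 1 = ((m + 1 : ℕ) : ℤ) by push_cast; ring] at this
    exact this
  · rw [abs_of_nonpos h] at hn
    obtain ⟨m, hm⟩ := Int.eq_ofNat_of_zero_le (neg_nonneg.2 h)
    obtain rfl : n = -(m : ℤ) := by omega
    refine halfLine_decay hl1 hl2 hl hz (v := fun m : ℕ => G (-(m : ℤ))) (fun m => hB _)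
      (tendsto_lp_apply G (neg_injective.comp Nat.cast_injective)) (fun m => ?_) hk hQ hQx
      (by omega)
    have := heq (n := -((m + 2 : ℕ) : ℤ)) (by omega)
    rw [show -((m + 2 : ℕ) : ℤ) + 1 = -((m + 1 : ℕ) : ℤ) by push_cast; ring,
      show -((m + 2 : ℕ) : ℤ) - 1 = -((m + 3 : ℕ) : ℤ) by push_cast; ring] at this
    -- Reflection turns the equation on the left half-line into the one with the hopping of the
    -- right half-line.
    have r1 := sturmianHopping_reflect (l1 := l1) (l2 := l2) (m := m + 1) (by omega)
    have r2 := sturmianHopping_reflect (l1 := l1) (l2 := l2) (m := m + 2) (by omega)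
    rw [show -((m + 1 : ℕ) : ℤ) - 1 = -((m + 2 : ℕ) : ℤ) by push_cast; ring] at r1
    rw [show -((m + 2 : ℕ) : ℤ) - 1 = -((m + 3 : ℕ) : ℤ) by push_cast; ring] at r2
    rw [r1, r2] at this
    simp only [fibHopping]
    rw [← this]; ring

theorem one_add_cube_le {q : ℝ} (hq : 0 ≤ q) : (1 + q) ^ 3 ≤ 8 * (1 + q ^ 3) := by
  nlinarith only [mul_nonneg hq (sq_nonneg (q - 1)), sq_nonneg (q - 1), pow_nonneg hq 3]

theorem add_sq_le_mul {u b : ℝ} (hb : 1 ≤ b) : (u + b) ^ 2 ≤ 2 * b ^ 2 * (1 + u ^ 2) := by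
  have h1 : 0 ≤ b ^ 2 - 1 := by nlinarith only [hb]
  nlinarith only [sq_nonneg (u - b), mul_nonneg (sq_nonneg u) h1]

/-- Interpolation between decay in the energy and smallness. -/
theorem mul_one_add_sq_pow_four_le {g r x η Q l : ℝ} (hg0 : 0 ≤ g) (hl : 0 < l) (hη : 0 < η)
    (hQ0 : 0 < Q) (hr : 0 ≤ r) (hxr : |x| ≤ r) (hrx : r ≤ |x| + 1) (b0 : g ≤ 1 / η)
    (b6 : g * r ^ 6 ≤ (2 * l) ^ 6 / η)
    (b2 : η * g ^ 2 ≤ (2 * ((r + l + 1) * (1 / η)) / Q) ^ 2) :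
    (g * (1 + x ^ 2)) ^ 4
      ≤ (8 * (1 + (2 * l) ^ 6)) ^ 2 * (8 * (l + 2) ^ 2) / (η ^ 5 * Q ^ 2) := by
  have s1 : g * (1 + x ^ 2) ^ 3 ≤ 8 * (1 + (2 * l) ^ 6) / η := by
    have e1 : (1 + x ^ 2) ^ 3 ≤ 8 * (1 + r ^ 6) := by
      have e2 : x ^ 2 ≤ r ^ 2 := by rw [← sq_abs]; exact pow_le_pow_left₀ (abs_nonneg _) hxr 2
      have e3 : (1 + x ^ 2) ^ 3 ≤ (1 + r ^ 2) ^ 3 :=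
        pow_le_pow_left₀ (by positivity) (by linarith) 3
      have e5 := one_add_cube_le (sq_nonneg r)
      rw [← pow_mul] at e5
      exact e3.trans e5
    calc g * (1 + x ^ 2) ^ 3 ≤ g * (8 * (1 + r ^ 6)) := mul_le_mul_of_nonneg_left e1 hg0
      _ = 8 * (g + g * r ^ 6) := by ring
      _ ≤ 8 * (1 / η + (2 * l) ^ 6 / η) := by linarith
      _ = _ := by ring
  have s2 : g ^ 2 ≤ 8 * (l + 2) ^ 2 * (1 + x ^ 2) / (η ^ 3 * Q ^ 2) := by
    have e1 : (r + l + 1) ^ 2 ≤ 2 * (l + 2) ^ 2 * (1 + x ^ 2) := by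
      rw [← sq_abs x]
      exact (pow_le_pow_left₀ (by positivity) (by linarith) 2).trans
        (add_sq_le_mul (by linarith : 1 ≤ l + 2))
    rw [le_div_iff₀ (by positivity)]
    have e2 : (2 * ((r + l + 1) * (1 / η)) / Q) ^ 2 * (η ^ 2 * Q ^ 2)
        = 4 * (r + l + 1) ^ 2 := by
      field_simp; ring
    have e3 := mul_le_mul_of_nonneg_right b2 (by positivity : 0 ≤ η ^ 2 * Q ^ 2)
    rw [e2] at e3
    calc g ^ 2 * (η ^ 3 * Q ^ 2) = η * g ^ 2 * (η ^ 2 * Q ^ 2) := by ring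
      _ ≤ _ := e3
      _ ≤ _ := by linarith
  have s3 := pow_le_pow_left₀ (by positivity) s1 2
  have hx1 : 1 ≤ 1 + x ^ 2 := by linarith [sq_nonneg x]
  have hx0 : 0 < 1 + x ^ 2 := by linarith
  -- The square of the energy bound times the smallness bound gives `g⁴ (1 + x²)⁶ ≤ const (1 + x²)`.
  -- The spare powers of `1 + x²` pay for the growth in energy of the smallness bound.
  have e1 := mul_le_mul s3 s2 (sq_nonneg g) (by positivity)
  have e2 : (8 * (1 + (2 * l) ^ 6) / η) ^ 2 * (8 * (l + 2) ^ 2 * (1 + x ^ 2) / (η ^ 3 * Q ^ 2))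
      = (8 * (1 + (2 * l) ^ 6)) ^ 2 * (8 * (l + 2) ^ 2) / (η ^ 5 * Q ^ 2) * (1 + x ^ 2) := by
    generalize 8 * (1 + (2 * l) ^ 6) = A
    field_simp
  rw [e2] at e1
  refine le_of_mul_le_mul_right (le_trans ?_ e1) hx0
  calc (g * (1 + x ^ 2)) ^ 4 * (1 + x ^ 2) = g ^ 4 * (1 + x ^ 2) ^ 5 := by ring
    _ ≤ g ^ 4 * (1 + x ^ 2) ^ 6 :=
        mul_le_mul_of_nonneg_left (pow_le_pow_right₀ hx1 (by norm_num)) (by positivity)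
    _ = _ := by ring

/-- On the line `Im z = η`, the index `k` is past the resolution scale, so the traces `k` and `k +
1` are already large, and `j` counts the further steps of escape. The condition `7 ≤ |n|` provides
the six steps away from site 1 needed for the `|z|⁻⁶` decay. -/
theorem evolution_decay (hl1 : 0 < l1) (hl2 : 0 < l2)
    (hl : l2 ≤ l1) (hc : c = (l1 ^ 2 - l2 ^ 2) / (l1 * l2)) (hc8 : 8 < c) (hδ : 0 < δ)
    (hδc : δ * (100 * c) ≤ 1) (hw1 : 1 ≤ w) (hw2 : w ^ 2 ≤ 2 * c - 4) (hwc : c - 1 ≤ w ^ 2)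
    (hw3 : w ^ 3 ≤ (c - 1) ^ 2) :
    ∃ C : ℝ, 0 < C ∧ ∀ η : ℝ, 0 < η → η ≤ 1 → ∀ (n : ℤ) (k j : ℕ), 2 ≤ k → 4 ≤ k + j →
      2 + δ < 1 / (l1 * w ^ 5) * w ^ k * η → (Nat.fib (k + j) : ℤ) + 1 ≤ |n| → 7 ≤ |n| →
      ∀ t : ℝ, 0 < t → (Real.exp (-η * t) * ‖evolution (fibonacciHamiltonian l1 l2) t n‖) ^ 4
        ≤ C / (η ^ 5 * ((1 + δ) ^ Nat.fib j) ^ 2) := by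
  obtain ⟨D, hD⟩ : ∃ D, D = (8 * (1 + (2 * l1) ^ 6)) ^ 2 * (8 * (l1 + 2) ^ 2) := ⟨_, rfl⟩
  have hD0 : 0 < D := by rw [hD]; positivity
  refine ⟨D * Real.pi ^ 4, by positivity, ?_⟩
  intro η hη hη1 n k j hk hkj hη2 hn hn7 t ht
  obtain ⟨Q, hQ⟩ : ∃ Q, Q = (1 + δ) ^ Nat.fib j := ⟨_, rfl⟩
  have hQ0 : 0 < Q := by rw [hQ]; positivity
  rw [← hQ]
  obtain ⟨R, hR⟩ : ∃ R, R = D / (η ^ 5 * Q ^ 2) := ⟨_, rfl⟩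
  have hR0 : 0 ≤ R := by rw [hR]; positivity
  obtain ⟨κ, hκ⟩ : ∃ κ, κ = √(√R) := ⟨_, rfl⟩
  have hκ4 : κ ^ 4 = R := by
    rw [hκ, show 4 = 2 * 2 from rfl, pow_mul, Real.sq_sqrt (Real.sqrt_nonneg _), Real.sq_sqrt hR0]
  have hκ0 : 0 ≤ κ := by rw [hκ]; positivity
  have key : ∀ x : ℝ, ‖evolutionLaplace (fibonacciHamiltonian l1 l2) (x + η * Complex.I) n‖
      ≤ κ / (1 + x ^ 2) := by
    intro x
    obtain ⟨z, hz⟩ : ∃ z : ℂ, z = x + η * Complex.I := ⟨_, rfl⟩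
    have hzi : z.im = η := by rw [hz]; simp
    have hzr : z.re = x := by rw [hz]; simp
    rw [← hz]
    obtain ⟨g, hg⟩ : ∃ g, g = ‖evolutionLaplace (fibonacciHamiltonian l1 l2) z n‖ := ⟨_, rfl⟩
    have hg0 : 0 ≤ g := hg ▸ norm_nonneg _
    have hxz : |x| ≤ ‖z‖ := hzr ▸ Complex.abs_re_le_norm z
    have hzx : ‖z‖ ≤ |x| + 1 := by
      have := Complex.norm_le_abs_re_add_abs_im z
      rw [hzr, hzi, abs_of_pos hη] at this
      linarith
    have b0 := norm_evolutionLaplace_mul_pow_le hl1 hl2 hl (z := z) (by rw [hzi]; exact hη) 0 n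
      (by simp)
    have b6 := norm_evolutionLaplace_mul_pow_le hl1 hl2 hl (z := z) (by rw [hzi]; exact hη) 6 n
      (by push_cast; grind)
    have b2 := norm_evolutionLaplace_sq_le hl1 hl2 hl (z := z) (by rw [hzi]; exact hη) hkj hQ0
      (hQ ▸ pow_fib_le_norm_trace hl1 hl2 hl hc hc8 hδ hδc hw1 hw2 hwc hw3 hk
        (by rwa [hzi, abs_of_pos hη])) hn
    rw [hzi, ← hg] at b0 b6 b2
    rw [← hg]
    simp only [pow_zero, mul_one] at b0
    have hx0 : 0 < 1 + x ^ 2 := by positivity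
    have s4 : (g * (1 + x ^ 2)) ^ 4 ≤ κ ^ 4 := by
      rw [hκ4, hR, hD]
      exact mul_one_add_sq_pow_four_le hg0 hl1 hη hQ0 (norm_nonneg z) hxz hzx b0 b6 b2
    rw [le_div_iff₀ hx0]
    exact le_of_pow_le_pow_left₀ (by norm_num) hκ0 s4
  have fin := exp_mul_norm_evolution_le (fibonacciHamiltonian_isSelfAdjoint l1 l2) hη key ht
  calc (Real.exp (-η * t) * ‖evolution (fibonacciHamiltonian l1 l2) t n‖) ^ 4
      ≤ (κ * Real.pi) ^ 4 := pow_le_pow_left₀ (by positivity) fin 4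
    _ = _ := by rw [mul_pow, hκ4, hR]; ring

end Decay

/-! ### Choice of scales and super-polynomial decay -/

theorem fib_mul_goldenRatio_le_pow (m : ℕ) :
    (Nat.fib m : ℝ) * Real.goldenRatio ≤ Real.goldenRatio ^ m ∧
      (Nat.fib (m + 1) : ℝ) * Real.goldenRatio ≤ Real.goldenRatio ^ (m + 1) := by
  induction m with
  | zero => simp
  | succ m ih =>
    refine ⟨ih.2, ?_⟩
    rw [Nat.fib_add_two, pow_add _ m 2, Real.goldenRatio_sq, mul_add, mul_one, ← pow_succ]
    push_cast
    linarith [ih.1, ih.2]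

theorem eventually_mul_le_fib (K : ℝ) : ∀ᶠ j : ℕ in atTop, K * j ≤ Nat.fib j := by
  have h1 : Tendsto (fun j : ℕ => (j : ℝ) ^ 1 / Real.goldenRatio ^ j) atTop (nhds 0) :=
    tendsto_pow_const_div_const_pow_of_one_lt 1 Real.one_lt_goldenRatio
  have h2 : Tendsto (fun j : ℕ => Real.goldenRatio ^ j) atTop atTop :=
    tendsto_pow_atTop_atTop_of_one_lt Real.one_lt_goldenRatio
  have h5 : 0 < √5 := by positivity
  have hε : 0 < 1 / (2 * (√5 * |K| + 1)) := by positivity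
  filter_upwards [h1.eventually_lt_const hε, h2.eventually_ge_atTop 2] with j hj hj2
  have hφ : 0 < Real.goldenRatio ^ j := pow_pos Real.goldenRatio_pos j
  rw [Real.coe_fib_eq, le_div_iff₀ h5]
  have h3 : Real.goldenConj ^ j ≤ 1 := by
    refine (le_abs_self _).trans ?_
    rw [abs_pow]
    refine pow_le_one₀ (abs_nonneg _) ?_
    rw [abs_le]
    exact ⟨by linarith [Real.neg_one_lt_goldenConj], by linarith [Real.goldenConj_neg]⟩
  rw [pow_one, div_lt_iff₀ hφ, one_div, ← div_eq_inv_mul, lt_div_iff₀ (by positivity)] at hj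
  have h6 : K * j * √5 ≤ j * (√5 * |K|) := by
    have := mul_le_mul_of_nonneg_right (le_abs_self K) (by positivity : 0 ≤ (j : ℝ) * √5)
    linarith
  have h7 : (0 : ℝ) ≤ j := Nat.cast_nonneg j
  linarith

/-- Choice of scales: a block index `k + j` of size at most `x` on the golden scale, with `k`
beyond the resolution scale and `fib j` super-linear in `x`. -/
theorem exists_scales {p q s : ℝ} (hp : 0 < p) (hq : 0 < q) (hs : 0 < s) (hpq : s * p < q)
    (b K : ℝ) : ∃ X : ℝ, ∀ x, X ≤ x → ∃ k j : ℕ, 2 ≤ k ∧ 4 ≤ k + j ∧ ((k + j : ℕ) : ℝ) * p ≤ x ∧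
      s * x + b < k * q ∧ K * x ≤ Nat.fib j := by
  -- With `k` near `(s x + b) / q` and `k + j` near `x / p`, the difference `j` grows at rate `ε`;
  -- half of it absorbs the rounding and `b`.
  obtain ⟨ε, hε⟩ : ∃ ε, ε = 1 / p - s / q := ⟨_, rfl⟩
  have hε0 : 0 < ε := by
    rw [hε, sub_pos, div_lt_div_iff₀ hq hp]; linarith
  obtain ⟨J, hJ⟩ := eventually_atTop.1 (eventually_mul_le_fib (2 * |K| / ε))
  obtain ⟨D, hD⟩ : ∃ D, D = b / q + 3 := ⟨_, rfl⟩
  refine ⟨max (max 0 (-b / s)) (max (2 * D / ε) (2 * (J + 2) / ε)), fun x hx => ?_⟩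
  obtain ⟨⟨hx0, hx1⟩, hx2, hx3⟩ : (0 ≤ x ∧ -b / s ≤ x) ∧ 2 * D / ε ≤ x ∧
    2 * (J + 2) / ε ≤ x := by simpa only [max_le_iff] using hx
  rw [div_le_iff₀ hs] at hx1
  rw [div_le_iff₀ hε0] at hx2 hx3
  have hy0 : 0 ≤ (s * x + b) / q := div_nonneg (by linarith) hq.le
  have hm1 := Nat.floor_le (div_nonneg hx0 hp.le)
  have hm2 := Nat.lt_floor_add_one (x / p)
  have hk1 := Nat.floor_le hy0
  have hk2 := Nat.lt_floor_add_one ((s * x + b) / q)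
  generalize ⌊x / p⌋₊ = m at hm1 hm2
  generalize ⌊(s * x + b) / q⌋₊ = k at hk1 hk2
  have e1 : x / p - (s * x + b) / q = ε * x - b / q := by rw [hε]; ring
  have hmk : ε * x / 2 + (k + 2 : ℕ) ≤ m := by
    push_cast
    have : D = b / q + 3 := hD
    linarith
  have hJ0 : (0 : ℝ) ≤ J := Nat.cast_nonneg J
  have hle : k + 2 ≤ m := by
    have : ((k + 2 : ℕ) : ℝ) ≤ m := by linarith
    exact_mod_cast this
  obtain ⟨j, rfl⟩ := Nat.exists_eq_add_of_le hle
  have hj : ε * x / 2 ≤ j := by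
    push_cast at hmk; linarith
  have hjJ : J + 2 ≤ j := by
    have : ((J + 2 : ℕ) : ℝ) ≤ j := by push_cast; linarith
    exact_mod_cast this
  refine ⟨k + 2, j, by omega, by omega, ?_, ?_, ?_⟩
  · rwa [le_div_iff₀ hp] at hm1
  · rw [div_lt_iff₀ hq] at hk2
    push_cast
    linarith
  · have h1 := hJ j (by omega)
    refine le_trans ?_ h1
    have h2 : K * x ≤ |K| * x := mul_le_mul_of_nonneg_right (le_abs_self K) hx0
    have h3 : 2 * |K| / ε * (ε * x / 2) ≤ 2 * |K| / ε * j :=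
      mul_le_mul_of_nonneg_left hj (by positivity)
    have h4 : 2 * |K| / ε * (ε * x / 2) = |K| * x := by field_simp
    linarith

section

variable {l1 l2 c δ w : ℝ}

/-- Super-polynomial smallness of the evolution outside the ball of radius `T ^ α`. -/
theorem evolution_superpolynomial_decay (hl1 : 0 < l1) (hl2 : 0 < l2)
    (hl : l2 ≤ l1) (hc : c = (l1 ^ 2 - l2 ^ 2) / (l1 * l2)) (hc8 : 8 < c) (hδ : 0 < δ)
    (hδc : δ * (100 * c) ≤ 1) (hw1 : 1 < w) (hw2 : w ^ 2 ≤ 2 * c - 4) (hwc : c - 1 ≤ w ^ 2)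
    (hw3 : w ^ 3 ≤ (c - 1) ^ 2) {α : ℝ} (hα : Real.log Real.goldenRatio / Real.log w < α) (M : ℕ) :
    ∃ N₀ : ℝ, 1 ≤ N₀ ∧ ∀ n : ℤ, N₀ ≤ |(n : ℝ)| → ∀ T : ℝ, 1 ≤ T → T ≤ |(n : ℝ)| ^ (1 / α) → ∀ t : ℝ,
      0 < t → Real.exp (-(1 / T) * t) * ‖evolution (fibonacciHamiltonian l1 l2) t n‖
        ≤ (1 / |(n : ℝ)|) ^ M := by
  obtain ⟨C, hC0, hC⟩ := evolution_decay hl1 hl2 hl hc hc8 hδ hδc hw1.le hw2 hwc hw3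
  have hp : 0 < Real.log Real.goldenRatio := Real.log_pos Real.one_lt_goldenRatio
  have hq : 0 < Real.log w := Real.log_pos hw1
  have hα0 : 0 < α := (div_pos hp hq).trans hα
  have hw0 : 0 < w := by linarith
  obtain ⟨lam, hlam⟩ : ∃ lam, lam = Real.log (1 + δ) := ⟨_, rfl⟩
  have hlam0 : 0 < lam := by rw [hlam]; exact Real.log_pos (by linarith)
  obtain ⟨C₁, hC₁⟩ : ∃ C₁, C₁ = (2 + δ) * (l1 * w ^ 5) := ⟨_, rfl⟩
  have hC₁0 : 0 < C₁ := by rw [hC₁]; positivity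
  -- The scale variable is `x = log |n|`. One index is worth `log φ` in block length and `log w` in
  -- resolution, and `log T ≤ x / α`. The last constant makes `(1 + δ)^(2 F_j)` exceed `C T⁵
  -- |n|^(4M)`.
  obtain ⟨X, hX⟩ := exists_scales hp hq (one_div_pos.2 hα0)
    (by rw [div_lt_iff₀ hq] at hα; rw [one_div, ← div_eq_inv_mul, div_lt_iff₀ hα0]; linarith)
    (Real.log C₁) ((|Real.log C| + 5 / α + 4 * M) / (2 * lam))
  refine ⟨max (Real.exp (max X 1)) 7, le_max_of_le_right (by norm_num), ?_⟩
  intro n hn T hT1 hT t ht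
  obtain ⟨N, hN⟩ : ∃ N, N = |(n : ℝ)| := ⟨_, rfl⟩
  rw [← hN] at hn hT ⊢
  have hN7 : 7 ≤ N := (le_max_right _ _).trans hn
  have hN0 : 0 < N := by linarith
  have hT0 : 0 < T := by linarith
  have hx : max X 1 ≤ Real.log N := by
    rw [Real.le_log_iff_exp_le hN0]; exact (le_max_left _ _).trans hn
  have hx1 : 1 ≤ Real.log N := (le_max_right _ _).trans hx
  obtain ⟨k, j, hk2, hkj, hkx, hkq, hjx⟩ := hX _ ((le_max_left _ _).trans hx)
  have hNn : ((|n| : ℤ) : ℝ) = N := by rw [hN]; push_cast; rfl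
  have hlogT : Real.log T ≤ 1 / α * Real.log N := by
    rw [← Real.log_rpow hN0]
    exact Real.log_le_log hT0 hT
  have hres : 2 + δ < 1 / (l1 * w ^ 5) * w ^ k * (1 / T) := by
    have h1 : Real.log (C₁ * T) < Real.log (w ^ k) := by
      rw [Real.log_mul hC₁0.ne' hT0.ne', Real.log_pow]; linarith
    have h2 := (Real.log_lt_log_iff (by positivity) (by positivity)).1 h1
    have h3 : 1 / (l1 * w ^ 5) * w ^ k * (1 / T) = w ^ k / (l1 * w ^ 5 * T) := by field_simp
    rw [h3, lt_div_iff₀ (by positivity)]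
    rw [hC₁] at h2; linarith
  have hfib : (Nat.fib (k + j) : ℤ) + 1 ≤ |n| := by
    have h1 : Real.goldenRatio ^ (k + j) ≤ N := by
      rw [← Real.log_le_log_iff (pow_pos Real.goldenRatio_pos _) hN0, Real.log_pow]
      exact hkx
    have h2 := (fib_mul_goldenRatio_le_pow (k + j)).1
    have h3 : (1.5 : ℝ) ≤ Real.goldenRatio := by
      have : (2 : ℝ) ≤ √5 := Real.le_sqrt_of_sq_le (by norm_num)
      unfold Real.goldenRatio; linarith
    have h4 : (Nat.fib (k + j) : ℝ) * 1.5 ≤ N := by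
      have := mul_le_mul_of_nonneg_left h3 (Nat.cast_nonneg (α := ℝ) (Nat.fib (k + j)))
      linarith
    have h5 : ((Nat.fib (k + j) + 1 : ℤ) : ℝ) ≤ ((|n| : ℤ) : ℝ) := by
      rw [hNn]; push_cast; linarith
    exact_mod_cast h5
  have hn7 : 7 ≤ |n| := by
    have : ((7 : ℤ) : ℝ) ≤ ((|n| : ℤ) : ℝ) := by rw [hNn]; push_cast; exact hN7
    exact_mod_cast this
  have hmain := hC (1 / T) (by positivity) ((div_le_one hT0).2 hT1) n k j hk2 hkj hres hfib hn7 t ht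
  refine le_of_pow_le_pow_left₀ (n := 4) (by norm_num) (by positivity) (hmain.trans ?_)
  have hQ0 : 0 < (1 + δ) ^ Nat.fib j := by positivity
  have h6 : C / ((1 / T) ^ 5 * ((1 + δ) ^ Nat.fib j) ^ 2)
      = C * T ^ 5 / ((1 + δ) ^ Nat.fib j) ^ 2 := by
    field_simp
  have h7 : ((1 / N) ^ M) ^ 4 = 1 / N ^ (4 * M) := by
    rw [← pow_mul, mul_comm M 4, div_pow, one_pow]
  rw [h6, h7, div_le_div_iff₀ (by positivity) (by positivity), one_mul,
    ← Real.log_le_log_iff (by positivity) (by positivity), Real.log_mul (by positivity)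
    (by positivity), Real.log_mul (by positivity) (by positivity), Real.log_pow, Real.log_pow,
    Real.log_pow, Real.log_pow, ← hlam]
  rw [div_mul_eq_mul_div, div_le_iff₀ (by positivity)] at hjx
  have h8 : Real.log C ≤ |Real.log C| * Real.log N :=
    (le_abs_self _).trans (le_mul_of_one_le_right (abs_nonneg _) hx1)
  have h9 : 5 / α * Real.log N = 5 * (1 / α * Real.log N) := by ring
  push_cast
  linarith

end

/-! ### From decay estimates to transport exponents -/

/-- Polynomial decay of every order outside the ball of radius `t ^ α - 2` makes the decay exponent
infinite. -/
theorem decayExponentUpper_eq_top {p : ℤ → ℝ → ℝ} {α : ℝ} (hα : 0 < α)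
    (h : ∀ M : ℕ, ∃ C T₀ : ℝ, ∀ t, T₀ ≤ t → ∀ n : ℤ, t ^ α - 2 < |(n : ℝ)| →
      p n t ≤ C * (1 / |(n : ℝ)|) ^ M) : decayExponentUpper p α = ⊤ := by
  rw [decayExponentUpper, EReal.neg_eq_top_iff]
  have hsum : ∃ S : ℝ, 0 < S ∧
      ∑' n : ℤ, ENNReal.ofReal ((1 / |(n : ℝ)|) ^ 2) ≤ ENNReal.ofReal S := by
    have h1 : Summable fun n : ℤ => (1 / |(n : ℝ)|) ^ 2 := by
      have := Real.summable_one_div_int_pow.2 (one_lt_two)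
      refine this.congr fun n => ?_
      rw [div_pow, one_pow, sq_abs]
    refine ⟨∑' n : ℤ, (1 / |(n : ℝ)|) ^ 2 + 1, ?_, ?_⟩
    · have : 0 ≤ ∑' n : ℤ, (1 / |(n : ℝ)|) ^ 2 := tsum_nonneg fun n => by positivity
      linarith
    · rw [← ENNReal.ofReal_tsum_of_nonneg (fun n => by positivity) h1]
      exact ENNReal.ofReal_le_ofReal (by linarith)
  obtain ⟨S, hS0, hS⟩ := hsum
  have key : ∀ M : ℕ, limsup (fun t : ℝ => ENNReal.log (outsideProb p (t ^ α - 2) t) /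
      ((Real.log t : ℝ) : EReal)) atTop ≤ ((-(α * M) + 1 : ℝ) : EReal) := by
    intro M
    -- Two extra powers make the sum over sites converge and the other `M` give `t^(-αM)`. The `+ 1`
    -- in the exponent absorbs all constants.
    obtain ⟨C, T₀, hC⟩ := h (M + 2)
    obtain ⟨C', hC'⟩ : ∃ C', C' = max C 1 := ⟨_, rfl⟩
    have hC'0 : 0 < C' := hC' ▸ lt_max_of_lt_right one_pos
    refine limsup_le_of_le (h := ?_)
    filter_upwards [eventually_ge_atTop T₀, eventually_gt_atTop 1,
      (tendsto_rpow_atTop hα).eventually_ge_atTop 4,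
      eventually_ge_atTop (C' * (2 ^ M * S))] with t ht0 ht1 htα htS
    have ht : 0 < t := by linarith
    have hlog : 0 < Real.log t := Real.log_pos ht1
    have hR : 0 < t ^ α / 2 := by positivity
    have hterm : ∀ n : {n : ℤ // t ^ α - 2 < |(n : ℝ)|}, ENNReal.ofReal (p n t)
        ≤ ENNReal.ofReal (C' * (1 / (t ^ α / 2)) ^ M) *
          ENNReal.ofReal ((1 / |((n : ℤ) : ℝ)|) ^ 2) := by
      rintro ⟨n, hn⟩
      rw [← ENNReal.ofReal_mul (by positivity)]
      refine ENNReal.ofReal_le_ofReal ((hC t ht0 n hn).trans ?_)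
      rw [pow_add, ← mul_assoc]
      refine mul_le_mul_of_nonneg_right ?_ (by positivity)
      refine mul_le_mul (hC' ▸ le_max_left _ _) ?_ (by positivity) hC'0.le
      refine pow_le_pow_left₀ (by positivity) ?_ M
      exact one_div_le_one_div_of_le hR (by linarith)
    have hP : outsideProb p (t ^ α - 2) t ≤ ENNReal.ofReal (t ^ (-(α * M) + 1)) := by
      calc outsideProb p (t ^ α - 2) t
          ≤ ∑' n : {n : ℤ // t ^ α - 2 < |(n : ℝ)|}, ENNReal.ofReal (C' * (1 / (t ^ α / 2)) ^ M) *
              ENNReal.ofReal ((1 / |((n : ℤ) : ℝ)|) ^ 2) := ENNReal.tsum_le_tsum hterm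
        _ = ENNReal.ofReal (C' * (1 / (t ^ α / 2)) ^ M) *
              ∑' n : {n : ℤ // t ^ α - 2 < |(n : ℝ)|},
                ENNReal.ofReal ((1 / |((n : ℤ) : ℝ)|) ^ 2) := ENNReal.tsum_mul_left
        _ ≤ ENNReal.ofReal (C' * (1 / (t ^ α / 2)) ^ M) * ENNReal.ofReal S := by
            gcongr
            exact (ENNReal.tsum_comp_le_tsum_of_injective Subtype.val_injective
              fun n : ℤ => ENNReal.ofReal ((1 / |(n : ℝ)|) ^ 2)).trans hS
        _ = ENNReal.ofReal (C' * (1 / (t ^ α / 2)) ^ M * S) := by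
            rw [← ENNReal.ofReal_mul (by positivity)]
        _ ≤ _ := by
            refine ENNReal.ofReal_le_ofReal ?_
            have e1 : (1 / (t ^ α / 2)) ^ M = 2 ^ M * t ^ (-(α * M)) := by
              rw [one_div_div, div_pow, ← Real.rpow_natCast (t ^ α), ← Real.rpow_mul ht.le,
                Real.rpow_neg ht.le, div_eq_mul_inv]
            rw [e1, Real.rpow_add ht, Real.rpow_one]
            have e2 : 0 < t ^ (-(α * M)) := by positivity
            have e3 := mul_le_mul_of_nonneg_left htS e2.le
            linarith
    have h1 : ENNReal.log (outsideProb p (t ^ α - 2) t)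
        ≤ (((-(α * M) + 1) * Real.log t : ℝ) : EReal) := by
      refine (ENNReal.log_monotone hP).trans (le_of_eq ?_)
      rw [ENNReal.log_ofReal_of_pos (by positivity), Real.log_rpow ht]
    refine (EReal.div_le_div_right_of_nonneg (by exact_mod_cast hlog.le) h1).trans (le_of_eq ?_)
    rw [← EReal.coe_div, mul_div_assoc, div_self hlog.ne', mul_one]
  rw [eq_bot_iff]
  refine le_of_forall_gt_imp_ge_of_dense fun x hx => ?_
  obtain ⟨y, -, hyx⟩ := EReal.lt_iff_exists_real_btwn.1 hx
  obtain ⟨M, hM⟩ := exists_nat_gt ((1 - y) / α)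
  refine (key M).trans (le_trans ?_ hyx.le)
  rw [div_lt_iff₀ hα] at hM
  exact_mod_cast (by linarith : -(α * M) + 1 ≤ y)

/-- If the decay exponent is infinite beyond `B`, the transport exponent is at most `B`. -/
theorem transportExponentUpper_le {p : ℤ → ℝ → ℝ} {B : ℝ}
    (h : ∀ α, B < α → decayExponentUpper p α = ⊤) : transportExponentUpper p ≤ (B : EReal) := by
  refine sSup_le ?_
  rintro x ⟨α, -, hα, rfl⟩
  by_contra! hcon
  exact hα.ne (h α (by exact_mod_cast hcon))

/-- Lowering `α` to `α'` absorbs both the `- 2` in the radius and the factor 2, which the time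
average requires. -/
theorem eventually_radius_le {α α' : ℝ} (hα' : 0 < α') (h : α' < α) :
    ∀ᶠ T : ℝ in atTop, ∀ r : ℝ, T ^ α - 2 < r → 2 * T ≤ r ^ (1 / α') := by
  filter_upwards [(tendsto_rpow_atTop (sub_pos.2 h)).eventually_ge_atTop (2 ^ α' + 2),
    eventually_ge_atTop 1] with T hT hT1 r hr
  have hT0 : 0 < T := by linarith
  have h1 : T ^ α = T ^ (α - α') * T ^ α' := by rw [← Real.rpow_add hT0]; congr 1; ring
  have h2 : (1 : ℝ) ≤ T ^ α' := Real.one_le_rpow hT1 hα'.le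
  have h3 : (2 * T) ^ α' ≤ r := by
    rw [Real.mul_rpow (by norm_num) hT0.le]
    have := mul_le_mul_of_nonneg_right hT (by linarith : 0 ≤ T ^ α')
    linarith
  have h4 := Real.rpow_le_rpow (by positivity) h3 (by positivity : 0 ≤ 1 / α')
  rwa [← Real.rpow_mul (by positivity), mul_one_div_cancel hα'.ne', Real.rpow_one] at h4

/-- These are the only facts about `ξ_c` that enter. The upper bound matches the two-iterate growth
factor; the lower one removes the offset `c - 1` in `SmallState` and makes `w > φ`. -/
theorem xiConst_bounds {c : ℝ} (hc8 : 8 < c) : c - 1 ≤ xiConst c ∧ xiConst c ≤ 2 * c - 4 := by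
  have h1 : 1 ≤ √(c ^ 2 - 4 * c + 1) := Real.le_sqrt_of_sq_le (by nlinarith)
  have h2 : √(c ^ 2 - 4 * c + 1) ≤ c - 2 := by
    rw [Real.sqrt_le_left (by linarith)]; nlinarith
  unfold xiConst
  constructor <;> linarith

section

variable {H : EllTwo →L[ℂ] EllTwo} {α α' : ℝ}

theorem decayExponentUpper_siteProb (hα' : 0 < α') (hα : α' < α)
    (h : ∀ M : ℕ, ∃ N₀ : ℝ, 1 ≤ N₀ ∧ ∀ n : ℤ, N₀ ≤ |(n : ℝ)| → ∀ T : ℝ, 1 ≤ T →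
      T ≤ |(n : ℝ)| ^ (1 / α') → ∀ t : ℝ, 0 < t →
        Real.exp (-(1 / T) * t) * ‖evolution H t n‖ ≤ (1 / |(n : ℝ)|) ^ M) :
    decayExponentUpper (siteProb H) α = ⊤ := by
  refine decayExponentUpper_eq_top (hα'.trans hα) fun M => ?_
  obtain ⟨N₀, hN1, hN⟩ := h M
  obtain ⟨T₀, hT₀⟩ := eventually_atTop.1 ((eventually_radius_le hα' hα).and
    (((tendsto_rpow_atTop (hα'.trans hα)).eventually_ge_atTop (N₀ + 2)).and
      (eventually_ge_atTop 1)))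
  refine ⟨Real.exp 1 ^ 2, T₀, fun t ht n hn => ?_⟩
  obtain ⟨h1, h2, h3⟩ := hT₀ t ht
  have ht0 : 0 < t := by linarith
  -- With time scale `T = t`, the damping costs only a factor `e`.
  have h4 := hN n (by linarith) t h3 ((by linarith [h1 _ hn]) : t ≤ _) t ht0
  rw [neg_mul, one_div_mul_cancel ht0.ne', Real.exp_neg, inv_mul_le_iff₀ (Real.exp_pos 1)] at h4
  rw [siteProb_eq]
  have hn1 : 1 / |(n : ℝ)| ≤ 1 := by rw [div_le_one (by linarith)]; linarith
  calc ‖evolution H t n‖ ^ 2 ≤ (Real.exp 1 * (1 / |(n : ℝ)|) ^ M) ^ 2 :=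
        pow_le_pow_left₀ (norm_nonneg _) h4 2
    _ = Real.exp 1 ^ 2 * ((1 / |(n : ℝ)|) ^ M * (1 / |(n : ℝ)|) ^ M) := by ring
    _ ≤ Real.exp 1 ^ 2 * ((1 / |(n : ℝ)|) ^ M * 1) := by
        gcongr
        exact pow_le_one₀ (by positivity) hn1
    _ = _ := by rw [mul_one]

theorem decayExponentUpper_siteProbAvg (hα' : 0 < α') (hα : α' < α)
    (h : ∀ M : ℕ, ∃ N₀ : ℝ, 1 ≤ N₀ ∧ ∀ n : ℤ, N₀ ≤ |(n : ℝ)| → ∀ T : ℝ, 1 ≤ T →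
      T ≤ |(n : ℝ)| ^ (1 / α') → ∀ t : ℝ, 0 < t →
        Real.exp (-(1 / T) * t) * ‖evolution H t n‖ ≤ (1 / |(n : ℝ)|) ^ M) :
    decayExponentUpper (siteProbAvg H) α = ⊤ := by
  refine decayExponentUpper_eq_top (hα'.trans hα) fun M => ?_
  obtain ⟨N₀, hN1, hN⟩ := h M
  obtain ⟨T₀, hT₀⟩ := eventually_atTop.1 ((eventually_radius_le hα' hα).and
    (((tendsto_rpow_atTop (hα'.trans hα)).eventually_ge_atTop (N₀ + 2)).and
      (eventually_ge_atTop 1)))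
  refine ⟨2, T₀, fun T hT n hn => ?_⟩
  obtain ⟨h1, h2, h3⟩ := hT₀ T hT
  have hT0 : 0 < T := by linarith
  have hn1 : 1 / |(n : ℝ)| ≤ 1 := by rw [div_le_one (by linarith)]; linarith
  obtain ⟨ε, hε⟩ : ∃ ε, ε = (1 / |(n : ℝ)|) ^ M := ⟨_, rfl⟩
  have hε0 : 0 ≤ ε := by rw [hε]; positivity
  have hε1 : ε ≤ 1 := by rw [hε]; exact pow_le_one₀ (by positivity) hn1
  have hpt : ∀ t ∈ Set.Ioi (0 : ℝ), Real.exp (-2 * t / T) * siteProb H n t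
      ≤ ε * Real.exp (-(1 / T) * t) := by
    intro t ht
    have h4 := hN n (by linarith) (2 * T) (by linarith) (h1 _ hn) t ht
    rw [← hε] at h4
    -- Half of the damping is kept for integrability in `t`; the other half is the square of the
    -- damping at time scale `2T`, where the pointwise bound applies.
    have e1 : Real.exp (-2 * t / T)
        = Real.exp (-(1 / T) * t) * Real.exp (-(1 / (2 * T)) * t) ^ 2 := by
      rw [← Real.exp_nat_mul, ← Real.exp_add]
      congr 1; field_simp; ring
    rw [e1, siteProb_eq]
    calc Real.exp (-(1 / T) * t) * Real.exp (-(1 / (2 * T)) * t) ^ 2 * ‖evolution H t n‖ ^ 2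
        = Real.exp (-(1 / T) * t) * (Real.exp (-(1 / (2 * T)) * t) * ‖evolution H t n‖) ^ 2 := by
          ring
      _ ≤ Real.exp (-(1 / T) * t) * ε := by
          refine mul_le_mul_of_nonneg_left ?_ (Real.exp_pos _).le
          refine (pow_le_pow_left₀ (by positivity) h4 2).trans ?_
          nlinarith
      _ = _ := mul_comm _ _
  have hTi : 0 < 1 / T := by positivity
  have hint : IntegrableOn (fun t => ε * Real.exp (-(1 / T) * t)) (Set.Ioi 0) :=
    (exp_neg_integrableOn_Ioi 0 hTi).const_mul ε
  have hle : ∫ t in Set.Ioi (0 : ℝ), Real.exp (-2 * t / T) * siteProb H n t ≤ ε * T := by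
    have e2 : ∫ t in Set.Ioi (0 : ℝ), ε * Real.exp (-(1 / T) * t) = ε * T := by
      rw [integral_const_mul, integral_exp_mul_Ioi (by linarith)]
      simp
    rw [← e2]
    refine integral_mono_of_nonneg (Eventually.of_forall fun t => ?_) hint ?_
    · exact mul_nonneg (Real.exp_pos _).le (sq_nonneg _)
    · exact (ae_restrict_mem measurableSet_Ioi).mono hpt
  rw [siteProbAvg, ← hε]
  calc 2 / T * ∫ t in Set.Ioi (0 : ℝ), Real.exp (-2 * t / T) * siteProb H n t
      ≤ 2 / T * (ε * T) := mul_le_mul_of_nonneg_left hle (by positivity)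
    _ = 2 * ε := by field_simp

end

/-! ### The transport bound -/

theorem theorem4 (l1 l2 c : ℝ) (hl1 : 0 < l1) (hl2 : 0 < l2)
    (hc : c = (l1 ^ 2 - l2 ^ 2) / (l1 * l2)) (hc8 : 8 < c) :
    alphaUpperAvg (fibonacciHamiltonian l1 l2)
        ≤ ((2 * Real.log ((√5 + 1) / 2) / Real.log (xiConst c) : ℝ) : EReal) ∧
      alphaUpper (fibonacciHamiltonian l1 l2)
        ≤ ((2 * Real.log ((√5 + 1) / 2) / Real.log (xiConst c) : ℝ) : EReal) ∧
      2 * Real.log ((√5 + 1) / 2) / Real.log (xiConst c) < 1 := by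
  obtain ⟨hξ1, hξ2⟩ := xiConst_bounds hc8
  have hφ : (√5 + 1) / 2 = Real.goldenRatio := by unfold Real.goldenRatio; ring
  obtain ⟨w, hw⟩ : ∃ w, w = √(xiConst c) := ⟨_, rfl⟩
  have hww : w ^ 2 = xiConst c := by rw [hw]; exact Real.sq_sqrt (by linarith)
  have hw1 : 1 < w := by rw [hw]; exact Real.lt_sqrt_of_sq_lt (by linarith)
  have hlogξ : Real.log (xiConst c) = 2 * Real.log w := by rw [← hww, Real.log_pow]; norm_num
  have hlogw : 0 < Real.log w := Real.log_pos hw1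
  have hp : 0 < Real.log Real.goldenRatio := Real.log_pos Real.one_lt_goldenRatio
  have hB : 2 * Real.log ((√5 + 1) / 2) / Real.log (xiConst c)
      = Real.log Real.goldenRatio / Real.log w := by
    rw [hφ, hlogξ, mul_div_mul_left _ _ two_ne_zero]
  have hl : l2 ≤ l1 := by
    by_contra! h
    have : c ≤ 0 := by
      rw [hc]
      exact div_nonpos_of_nonpos_of_nonneg (by nlinarith) (by positivity)
    linarith
  have hw3 : w ^ 3 ≤ (c - 1) ^ 2 := by
    refine le_of_pow_le_pow_left₀ (n := 2) two_ne_zero (sq_nonneg _) ?_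
    have h1 : (w ^ 3) ^ 2 ≤ (2 * c - 4) ^ 3 := by
      rw [← pow_mul, mul_comm, pow_mul, hww]
      exact pow_le_pow_left₀ (by linarith) hξ2 3
    -- In the variable `d = c - 8 ≥ 0` the difference of the two sides has only positive
    -- coefficients.
    have h2 : (2 * c - 4) ^ 3 ≤ ((c - 1) ^ 2) ^ 2 := by
      obtain ⟨d, hd⟩ : ∃ d, d = c - 8 := ⟨_, rfl⟩
      have hd0 : 0 ≤ d := by linarith
      obtain rfl : c = d + 8 := by linarith
      have : ((d + 8 - 1) ^ 2) ^ 2 - (2 * (d + 8) - 4) ^ 3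
          = d ^ 4 + 20 * d ^ 3 + 150 * d ^ 2 + 508 * d + 673 := by ring
      have : 0 ≤ d ^ 4 + 20 * d ^ 3 + 150 * d ^ 2 + 508 * d + 673 := by positivity
      linarith
    exact h1.trans h2
  have hdecay : ∀ α, Real.log Real.goldenRatio / Real.log w < α → ∀ M : ℕ, _ := fun α hα M =>
    evolution_superpolynomial_decay hl1 hl2 hl hc hc8 (δ := 1 / (100 * c)) (by positivity)
      (by rw [one_div_mul_cancel]; positivity) hw1 (hww ▸ hξ2) (hww ▸ hξ1) hw3 hα M
  have hB0 : 0 < Real.log Real.goldenRatio / Real.log w := div_pos hp hlogw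
  rw [hB]
  refine ⟨transportExponentUpper_le fun α hα => ?_, transportExponentUpper_le fun α hα => ?_, ?_⟩
  · obtain ⟨α', h1, h2⟩ := exists_between hα
    exact decayExponentUpper_siteProbAvg (hB0.trans h1) h2 (hdecay α' h1)
  · obtain ⟨α', h1, h2⟩ := exists_between hα
    exact decayExponentUpper_siteProb (hB0.trans h1) h2 (hdecay α' h1)
  · rw [div_lt_one hlogw]
    refine Real.log_lt_log Real.goldenRatio_pos ?_
    -- `w > 2` because `ξ_c ≥ c - 1 > 7`.
    refine Real.goldenRatio_lt_two.trans ?_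
    rw [hw]
    exact Real.lt_sqrt_of_sq_lt (by linarith)
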